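/- **Theorem 1 (Extreme value theorem for geometric Brownian motion).** Let $\mu,\sigma>0$ and $B>1$ be real constants. There exist constants $C>0$ and $T_0>0$, depending only on $\mu,\sigma,B$, such that the following holds. Let $(\Omega,\mathcal F,\mathbb P)$ be a probability space with a filtration $(\mathcal F_t)_{t\ge 0}$, let $W$ be a standard one-dimensional Brownian motion relative to $(\mathcal F_t)$ (adapted, with $W_t-W_s$ independent of $\mathcal F_s$ for $s\le t$), and let $X$ be a continuous adapted solution of the Itô stochastic differential equation $$dX_t=\mu X_t\,dt+\sigma X_t\,dW_t,\qquad X_0=1 .$$ For $T>0$ let $A_T=\{\max_{0\le t\le T}X_t\ge B\}$. Then for every $0<T<T_0$ one has $\mathbb P(A_T)>0$, and, with $\mathbb P_T(E)=\mathbb P(E\cap A_T)/\mathbb P(A_T)$ for events $E$ and $\mathbb E_{\mathbb P_T}$ the expectation under $\mathbb P_T$, the random variable $\sup_{0\le t\le T}|X_t-B^{t/T}|$ is $\mathbb P_T$-integrable and $$\mathbb E_{\mathbb P_T}\Big[\sup_{0\le t\le T}\big|X_t-B^{t/T}\big|\Big]\le C\sqrt T .$$ In other words, this conditional expectation is $O(\sqrt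 T)$ as $T\to0^+$, with implied constants depending only on $\mu,\sigma,B$. -/

import Mathlib

open MeasureTheory ProbabilityTheory Filter Topology
open scoped NNReal ENNReal

/-- `W` is a standard one-dimensional Brownian motion relative to the filtration `𝓕`: it is a
Brownian motion, it is adapted, and its increments after time `s` are independent of `𝓕 s`. -/
structure IsBrownianWrt {Ω : Type*} {mΩ : MeasurableSpace Ω} (𝓕 : Filtration ℝ≥0 mΩ)
    (W : ℝ≥0 → Ω → ℝ) (P : Measure Ω) : Prop where
  isBrownian : IsBrownianReal W P
  adapted : Adapted 𝓕 W
  indep : ∀ s t : ℝ≥0, s ≤ t →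
    Indep (MeasurableSpace.comap (fun ω ↦ W t ω - W s ω) inferInstance) (𝓕 s) P

/-- An elementary process `∑_{i < k} ξ_i 1_{(t_i, t_{i+1}]}`, with `t_0 ≤ t_1 ≤ ⋯` deterministic
and `ξ_i` real-valued and `𝓕 t_i`-measurable. -/
structure ElementaryProcess {Ω : Type*} {mΩ : MeasurableSpace Ω} (𝓕 : Filtration ℝ≥0 mΩ) where
  k : ℕ
  time : ℕ → ℝ≥0
  mono : Monotone time
  ξ : ℕ → Ω → ℝ
  meas : ∀ i, Measurable[𝓕 (time i)] (ξ i)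

namespace ElementaryProcess

/-- The value of an elementary process at time `s`. -/
noncomputable def value {Ω : Type*} {mΩ : MeasurableSpace Ω} {𝓕 : Filtration ℝ≥0 mΩ}
    (S : ElementaryProcess 𝓕) (s : ℝ≥0) (ω : Ω) : ℝ :=
  ∑ i ∈ Finset.range S.k, (Set.Ioc (S.time i) (S.time (i + 1))).indicator (fun _ ↦ S.ξ i ω) s

/-- The elementary stochastic integral over `[0, t]`,
`∑_{i < k} ξ_i (W_{t_{i+1} ∧ t} - W_{t_i ∧ t})`. -/
noncomputable def integral {Ω : Type*} {mΩ : MeasurableSpace Ω} {𝓕 : Filtration ℝ≥0 mΩ}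
    (S : ElementaryProcess 𝓕) (W : ℝ≥0 → Ω → ℝ) (t : ℝ≥0) (ω : Ω) : ℝ :=
  ∑ i ∈ Finset.range S.k,
    S.ξ i ω * (W (min (S.time (i + 1)) t) ω - W (min (S.time i) t) ω)

end ElementaryProcess

/-- The elementary processes `S n` approximate `H` on `[0, t]`:
`∫_0^t |S n - H|² ds → 0` in probability. -/
def ApproximatesOn {Ω : Type*} {mΩ : MeasurableSpace Ω} {𝓕 : Filtration ℝ≥0 mΩ}
    (S : ℕ → ElementaryProcess 𝓕) (H : ℝ≥0 → Ω → ℝ) (t : ℝ≥0) (P : Measure Ω) : Prop :=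
  ∀ ε : ℝ≥0∞, 0 < ε → Tendsto
    (fun n ↦ P {ω | ε ≤ ∫⁻ s in Set.Ioc (0 : ℝ) t,
      ENNReal.ofReal (((S n).value s.toNNReal ω - H s.toNNReal ω) ^ 2)}) atTop (𝓝 0)

/-- `I` is the Itô integral `∫_0^t H dW`: elementary processes approximating `H` on `[0, t]` exist,
and for every such approximation the elementary integrals converge to `I` in probability. -/
def IsItoIntegral {Ω : Type*} {mΩ : MeasurableSpace Ω} (𝓕 : Filtration ℝ≥0 mΩ)
    (W : ℝ≥0 → Ω → ℝ) (P : Measure Ω) (H : ℝ≥0 → Ω → ℝ) (t : ℝ≥0) (I : Ω → ℝ) : Prop :=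
  (∃ S : ℕ → ElementaryProcess 𝓕, ApproximatesOn S H t P) ∧
    ∀ S : ℕ → ElementaryProcess 𝓕, ApproximatesOn S H t P →
      TendstoInMeasure P (fun n ↦ (S n).integral W t) atTop I

/-- `X` is a continuous adapted solution of `dX = μ X dt + σ X dW`, `X_0 = 1`, that is,
`X_t = 1 + ∫_0^t μ X_s ds + ∫_0^t σ X_s dW_s` almost surely for every `t`. -/
structure IsGeometricBrownianMotion {Ω : Type*} {mΩ : MeasurableSpace Ω} (𝓕 : Filtration ℝ≥0 mΩ)
    (W : ℝ≥0 → Ω → ℝ) (P : Measure Ω) (μ σ : ℝ) (X : ℝ≥0 → Ω → ℝ) : Prop where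
  adapted : Adapted 𝓕 X
  cont : ∀ᵐ ω ∂P, Continuous (X · ω)
  eqn : ∃ I : ℝ≥0 → Ω → ℝ,
    (∀ t, IsItoIntegral 𝓕 W P (fun s ω ↦ σ * X s ω) t (I t)) ∧
    ∀ t : ℝ≥0, ∀ᵐ ω ∂P,
      X t ω = 1 + (∫ s in (0 : ℝ)..t, μ * X s.toNNReal ω) + I t ω

/-- The running maximum `max_{0 ≤ t ≤ T} X_t`. -/
noncomputable def runningMax {Ω : Type*} (X : ℝ≥0 → Ω → ℝ) (T : ℝ≥0) (ω : Ω) : ℝ :=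
  ⨆ t : Set.Icc (0 : ℝ≥0) T, X t ω

/-- The event `A_T = {max_{0 ≤ t ≤ T} X_t ≥ B}`. -/
def hitEvent {Ω : Type*} (X : ℝ≥0 → Ω → ℝ) (B : ℝ) (T : ℝ≥0) : Set Ω :=
  {ω | B ≤ runningMax X T ω}

/-- The random variable `sup_{0 ≤ t ≤ T} |X_t - B^{t/T}|`. -/
noncomputable def supDeviation {Ω : Type*} (X : ℝ≥0 → Ω → ℝ) (B : ℝ) (T : ℝ≥0) (ω : Ω) : ℝ :=
  ⨆ t : Set.Icc (0 : ℝ≥0) T, |X t ω - B ^ ((t : ℝ) / (T : ℝ))|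

/-!
Itô's formula is replaced by Euler sums: along uniform grids the Euler sums of `X` and of the
explicit process `exp (σ W_t + (μ - σ² / 2) t)` converge in probability to `X - 1` and to the
explicit process minus one, and an `L²` Gronwall argument for the difference, stopped when it leaves
`[-N, N]`, shows that `X` is the explicit process.

For this process `log X_t = (t / T) log X_T + σ β_t` on `[0, T]`, where `β` is a Brownian bridge of
size `√T`, independent of the excess `y = log X_T - log B`. The deviation from `B ^ (t / T)` is
therefore of order `√T + |y|`, up to exponential factors. If `y < 0`, then `X` reaches `B` only if
the bridge crosses a line, which has probability `exp (2 y log B / (σ² T))`, whereas the density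
of `log X_T - log B` at `y` exceeds its value `p` at `0` only by a factor of about
`exp (-y log B / (σ² T))`. Hence `|y|` is of order `T` on the event of reaching `B`: the integral of
the deviation over this event is at most a constant times `p T √T`, while the probability of the
event is at least a constant times `p T`.
-/

/-! ### Orthogonal sums -/

section OrthogonalSums

variable {Ω : Type*} {mΩ : MeasurableSpace Ω} {P : Measure Ω}

lemma indepFun_of_measurable_of_indep {β γ : Type*} [MeasurableSpace β] [MeasurableSpace γ]
    {m : MeasurableSpace Ω} {ξ : Ω → β} {η : Ω → γ} (hξ : Measurable[m] ξ)
    (h : Indep (MeasurableSpace.comap η inferInstance) m P) : IndepFun ξ η P :=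
  (IndepFun_iff_Indep ξ η P).2 (indep_of_indep_of_le_right h hξ.comap_le).symm

lemma integral_sq_mul_of_indepFun {ξ η : Ω → ℝ} (hξ : AEMeasurable ξ P) (hη : AEMeasurable η P)
    (h : IndepFun ξ η P) :
    ∫ ω, (ξ ω * η ω) ^ 2 ∂P = (∫ ω, ξ ω ^ 2 ∂P) * ∫ ω, η ω ^ 2 ∂P := by
  have hsq : IndepFun (fun ω ↦ ξ ω ^ 2) (fun ω ↦ η ω ^ 2) P :=
    h.comp (φ := fun x ↦ x ^ 2) (ψ := fun x ↦ x ^ 2) (by fun_prop) (by fun_prop)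
  simp_rw [mul_pow]
  exact hsq.integral_fun_mul_eq_mul_integral (hξ.pow_const 2).aestronglyMeasurable
    (hη.pow_const 2).aestronglyMeasurable

lemma memLp_two_mul_of_indepFun {ξ η : Ω → ℝ} (hξ : MemLp ξ 2 P) (hη : MemLp η 2 P)
    (h : IndepFun ξ η P) : MemLp (fun ω ↦ ξ ω * η ω) 2 P := by
  rw [memLp_two_iff_integrable_sq (f := fun ω ↦ ξ ω * η ω) (hξ.1.mul hη.1)]
  have hsq : IndepFun (fun ω ↦ ξ ω ^ 2) (fun ω ↦ η ω ^ 2) P :=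
    h.comp (φ := fun x ↦ x ^ 2) (ψ := fun x ↦ x ^ 2) (by fun_prop) (by fun_prop)
  simpa only [mul_pow, Pi.mul_def] using hsq.integrable_mul hξ.integrable_sq hη.integrable_sq

lemma integral_sq_sum_of_orthogonal {ι : Type*} (s : Finset ι) {x : ι → Ω → ℝ}
    (hx : ∀ i, MemLp (x i) 2 P) (horth : Pairwise fun i j ↦ ∫ ω, x i ω * x j ω ∂P = 0) :
    ∫ ω, (∑ i ∈ s, x i ω) ^ 2 ∂P = ∑ i ∈ s, ∫ ω, x i ω ^ 2 ∂P := by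
  have hint i j : Integrable (fun ω ↦ x i ω * x j ω) P := (hx i).integrable_mul (hx j)
  simp_rw [sq, Finset.sum_mul_sum]
  rw [integral_finsetSum _ fun i _ ↦ integrable_finsetSum _ fun j _ ↦ hint i j]
  refine Finset.sum_congr rfl fun i hi ↦ ?_
  rw [integral_finsetSum _ fun j _ ↦ hint i j]
  exact Finset.sum_eq_single_of_mem i hi fun j _ hji ↦ horth hji.symm

variable {𝓖 : ℕ → MeasurableSpace Ω} {ξ η : ℕ → Ω → ℝ}

lemma integral_mul_martingale_differences_eq_zero (hmono : Monotone 𝓖)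
    (hξ : ∀ i, Measurable[𝓖 i] (ξ i)) (hη : ∀ i, Measurable[𝓖 (i + 1)] (η i))
    (hξm : ∀ i, AEStronglyMeasurable (ξ i) P) (hηm : ∀ i, AEStronglyMeasurable (η i) P)
    (hind : ∀ i, Indep (MeasurableSpace.comap (η i) inferInstance) (𝓖 i) P)
    (h0 : ∀ i, ∫ ω, η i ω ∂P = 0) :
    Pairwise fun i j ↦ ∫ ω, (ξ i ω * η i ω) * (ξ j ω * η j ω) ∂P = 0 := by
  have hlt {i j : ℕ} (hij : i < j) : ∫ ω, (ξ i ω * η i ω) * (ξ j ω * η j ω) ∂P = 0 := by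
    have hpast : Measurable[𝓖 j] fun ω ↦ ξ i ω * η i ω * ξ j ω :=
      (((hξ i).mono (hmono hij.le) le_rfl).mul ((hη i).mono (hmono hij) le_rfl)).mul (hξ j)
    simp_rw [← mul_assoc]
    rw [(indepFun_of_measurable_of_indep hpast (hind j)).integral_fun_mul_eq_mul_integral
      (((hξm i).mul (hηm i)).mul (hξm j)) (hηm j), h0, mul_zero]
  intro i j hij
  rcases hij.lt_or_gt with h | h
  · exact hlt h
  · simpa only [mul_comm] using hlt h

lemma integral_sq_sum_mul_le_of_centered (hmono : Monotone 𝓖)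
    (hξ : ∀ i, Measurable[𝓖 i] (ξ i)) (hη : ∀ i, Measurable[𝓖 (i + 1)] (η i))
    (hξ2 : ∀ i, MemLp (ξ i) 2 P) (hη2 : ∀ i, MemLp (η i) 2 P)
    (hind : ∀ i, Indep (MeasurableSpace.comap (η i) inferInstance) (𝓖 i) P)
    (h0 : ∀ i, ∫ ω, η i ω ∂P = 0) {v : ℝ} (hv : ∀ i, ∫ ω, η i ω ^ 2 ∂P ≤ v) (n : ℕ) :
    ∫ ω, (∑ i ∈ Finset.range n, ξ i ω * η i ω) ^ 2 ∂P
      ≤ v * ∑ i ∈ Finset.range n, ∫ ω, ξ i ω ^ 2 ∂P := by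
  have hindep i : IndepFun (ξ i) (η i) P := indepFun_of_measurable_of_indep (hξ i) (hind i)
  rw [integral_sq_sum_of_orthogonal _
    (fun i ↦ memLp_two_mul_of_indepFun (hξ2 i) (hη2 i) (hindep i))
    (integral_mul_martingale_differences_eq_zero hmono hξ hη (fun i ↦ (hξ2 i).1)
      (fun i ↦ (hη2 i).1) hind h0), Finset.mul_sum]
  refine Finset.sum_le_sum fun i _ ↦ ?_
  rw [integral_sq_mul_of_indepFun (hξ2 i).1.aemeasurable (hη2 i).1.aemeasurable (hindep i),
    mul_comm]
  exact mul_le_mul_of_nonneg_right (hv i) (integral_nonneg fun ω ↦ sq_nonneg _)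

lemma integral_sub_integral_sq_le [IsProbabilityMeasure P] {Y : Ω → ℝ} (hY : AEMeasurable Y P) :
    ∫ ω, (Y ω - ∫ ω', Y ω' ∂P) ^ 2 ∂P ≤ ∫ ω, Y ω ^ 2 ∂P := by
  rw [← variance_eq_integral hY]
  exact variance_le_expectation_sq hY.aestronglyMeasurable

lemma sq_sum_mul_le (n : ℕ) (x y : ℕ → ℝ) (r : ℝ) :
    (∑ i ∈ Finset.range n, x i * y i) ^ 2 ≤
      2 * (∑ i ∈ Finset.range n, x i * (y i - r)) ^ 2 +
        2 * n * r ^ 2 * ∑ i ∈ Finset.range n, x i ^ 2 := by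
  have hsplit : ∑ i ∈ Finset.range n, x i * y i =
      ∑ i ∈ Finset.range n, x i * (y i - r) + r * ∑ i ∈ Finset.range n, x i := by
    rw [Finset.mul_sum, ← Finset.sum_add_distrib]
    exact Finset.sum_congr rfl fun i _ ↦ by ring
  have hcs : (∑ i ∈ Finset.range n, x i) ^ 2 ≤ n * ∑ i ∈ Finset.range n, x i ^ 2 := by
    simpa using sq_sum_le_card_mul_sum_sq (s := Finset.range n) (f := x)
  calc _ ≤ 2 * ((∑ i ∈ Finset.range n, x i * (y i - r)) ^ 2 +
        (r * ∑ i ∈ Finset.range n, x i) ^ 2) := by rw [hsplit]; exact add_sq_le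
    _ ≤ 2 * ((∑ i ∈ Finset.range n, x i * (y i - r)) ^ 2 +
        r ^ 2 * (n * ∑ i ∈ Finset.range n, x i ^ 2)) := by rw [mul_pow]; gcongr
    _ = _ := by ring

lemma integral_sq_sum_mul_le [IsProbabilityMeasure P] (hmono : Monotone 𝓖)
    (hξ : ∀ i, Measurable[𝓖 i] (ξ i)) (hη : ∀ i, Measurable[𝓖 (i + 1)] (η i))
    (hξ2 : ∀ i, MemLp (ξ i) 2 P) (hη2 : ∀ i, MemLp (η i) 2 P)
    (hind : ∀ i, Indep (MeasurableSpace.comap (η i) inferInstance) (𝓖 i) P)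
    {r v : ℝ} (hr : ∀ i, ∫ ω, η i ω ∂P = r) (hv : ∀ i, ∫ ω, η i ω ^ 2 ∂P ≤ v) (n : ℕ) :
    ∫ ω, (∑ i ∈ Finset.range n, ξ i ω * η i ω) ^ 2 ∂P
      ≤ 2 * (v + n * r ^ 2) * ∑ i ∈ Finset.range n, ∫ ω, ξ i ω ^ 2 ∂P := by
  have hη2' i : MemLp (fun ω ↦ η i ω - r) 2 P := (hη2 i).sub (memLp_const r)
  have hind' i : Indep (MeasurableSpace.comap (fun ω ↦ η i ω - r) inferInstance) (𝓖 i) P :=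
    indep_of_indep_of_le_left (hind i)
      (((measurable_id.sub_const r).comp (comap_measurable (η i))).comap_le)
  have h0 i : ∫ ω, (η i ω - r) ∂P = 0 := by
    rw [integral_sub ((hη2 i).integrable one_le_two) (integrable_const _), hr]; simp
  have hv' i : ∫ ω, (η i ω - r) ^ 2 ∂P ≤ v := by
    refine le_trans ?_ (hv i)
    simpa only [hr] using integral_sub_integral_sq_le (hη2 i).1.aemeasurable
  have hcentered := integral_sq_sum_mul_le_of_centered hmono hξ (fun i ↦ (hη i).sub_const r)
    hξ2 hη2' hind' h0 hv' n
  have hI1 : Integrable (fun ω ↦ (∑ i ∈ Finset.range n, ξ i ω * (η i ω - r)) ^ 2) P :=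
    (memLp_finsetSum _ fun i _ ↦ memLp_two_mul_of_indepFun (hξ2 i) (hη2' i)
      (indepFun_of_measurable_of_indep (hξ i) (hind' i))).integrable_sq
  have hI2 : Integrable (fun ω ↦ ∑ i ∈ Finset.range n, ξ i ω ^ 2) P :=
    integrable_finsetSum _ fun i _ ↦ (hξ2 i).integrable_sq
  calc ∫ ω, (∑ i ∈ Finset.range n, ξ i ω * η i ω) ^ 2 ∂P
      ≤ ∫ ω, (2 * (∑ i ∈ Finset.range n, ξ i ω * (η i ω - r)) ^ 2 +
          2 * n * r ^ 2 * ∑ i ∈ Finset.range n, ξ i ω ^ 2) ∂P :=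
        integral_mono_of_nonneg (.of_forall fun ω ↦ sq_nonneg _)
          ((hI1.const_mul 2).add (hI2.const_mul _)) (.of_forall fun ω ↦ sq_sum_mul_le ..)
    _ = 2 * ∫ ω, (∑ i ∈ Finset.range n, ξ i ω * (η i ω - r)) ^ 2 ∂P +
          2 * n * r ^ 2 * ∑ i ∈ Finset.range n, ∫ ω, ξ i ω ^ 2 ∂P := by
        rw [integral_add (hI1.const_mul 2) (hI2.const_mul _), integral_const_mul,
          integral_const_mul, integral_finsetSum _ fun i _ ↦ (hξ2 i).integrable_sq]
    _ ≤ 2 * (v * ∑ i ∈ Finset.range n, ∫ ω, ξ i ω ^ 2 ∂P) +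
          2 * n * r ^ 2 * ∑ i ∈ Finset.range n, ∫ ω, ξ i ω ^ 2 ∂P := by gcongr
    _ = _ := by ring

end OrthogonalSums

/-! ### One Euler step under a Gaussian increment -/

section EulerStep

lemma abs_exp_sub_one_sub_le (x : ℝ) : |Real.exp x - 1 - x| ≤ x ^ 2 * Real.exp |x| := by
  have hlower := Real.add_one_le_exp x
  rw [abs_of_nonneg (by linarith)]
  have hupper : Real.exp x * (1 - x) ≤ 1 := by
    calc Real.exp x * (1 - x) ≤ Real.exp x * Real.exp (-x) := by
          gcongr; linarith [Real.add_one_le_exp (-x)]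
      _ = 1 := by rw [← Real.exp_add, add_neg_cancel, Real.exp_zero]
  have hmul : x * (Real.exp x - 1) ≤ x ^ 2 * Real.exp |x| := by
    rcases le_or_gt 0 x with hx | hx
    · rw [abs_of_nonneg hx]; nlinarith
    · nlinarith [sq_nonneg x, Real.one_le_exp (abs_nonneg x)]
  nlinarith

/-- The increment over a step of length `d`, relative to the current value, in the Euler scheme of
`dX = μ X dt + σ X dW`, as a function of the Brownian increment `w`. -/
def eulerStep (μ σ d w : ℝ) : ℝ := μ * d + σ * w

/-- The difference between the exact relative increment of geometric Brownian motion over a step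
of length `d` with Brownian increment `w`, and that of the Euler scheme. -/
noncomputable def eulerRemainder (μ σ d w : ℝ) : ℝ :=
  Real.exp (σ * w + (μ - σ ^ 2 / 2) * d) - 1 - eulerStep μ σ d w

@[fun_prop]
lemma measurable_eulerStep (μ σ d : ℝ) : Measurable (eulerStep μ σ d) := by
  unfold eulerStep
  fun_prop

@[fun_prop]
lemma measurable_eulerRemainder (μ σ d : ℝ) : Measurable (eulerRemainder μ σ d) := by
  unfold eulerRemainder
  fun_prop

lemma memLp_two_eulerStep (μ σ d : ℝ) (v : ℝ≥0) : MemLp (eulerStep μ σ d) 2 (gaussianReal 0 v) :=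
  (memLp_const (μ * d)).add ((memLp_id_gaussianReal (μ := 0) (v := v) 2).const_mul σ)

lemma map_eulerStep_gaussianReal (μ σ d : ℝ) (v : ℝ≥0) :
    (gaussianReal 0 v).map (eulerStep μ σ d) =
      gaussianReal (μ * d) (.mk (σ ^ 2) (sq_nonneg σ) * v) := by
  have hcomp : eulerStep μ σ d = (μ * d + ·) ∘ (σ * ·) := rfl
  rw [hcomp, ← Measure.map_map (by fun_prop) (by fun_prop), gaussianReal_map_const_mul,
    gaussianReal_map_const_add, mul_zero, zero_add]

lemma integral_eulerStep (μ σ d : ℝ) (v : ℝ≥0) :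
    ∫ w, eulerStep μ σ d w ∂(gaussianReal 0 v) = μ * d := by
  rw [← integral_map (f := fun x ↦ x) (by fun_prop) (by fun_prop), map_eulerStep_gaussianReal,
    integral_id_gaussianReal]

lemma integral_eulerStep_sq (μ σ d : ℝ) (v : ℝ≥0) :
    ∫ w, eulerStep μ σ d w ^ 2 ∂(gaussianReal 0 v) = (μ * d) ^ 2 + σ ^ 2 * v := by
  have hvar := variance_eq_sub (memLp_two_eulerStep μ σ d v)
  rw [← variance_id_map (by fun_prop), map_eulerStep_gaussianReal, variance_id_gaussianReal,
    integral_eulerStep] at hvar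
  simp only [NNReal.coe_mul, NNReal.coe_mk, Pi.pow_apply] at hvar
  linarith

lemma memLp_two_exp_mul_gaussianReal (m a : ℝ) (v : ℝ≥0) :
    MemLp (fun w ↦ Real.exp (a * w)) 2 (gaussianReal m v) := by
  rw [memLp_two_iff_integrable_sq (by fun_prop)]
  simpa only [← Real.exp_nat_mul, ← mul_assoc, Nat.cast_ofNat] using
    integrable_exp_mul_gaussianReal (μ := m) (v := v) (2 * a)

lemma integral_exp_mul_gaussianReal_zero (a : ℝ) (v : ℝ≥0) :
    ∫ w, Real.exp (a * w) ∂(gaussianReal 0 v) = Real.exp (v * a ^ 2 / 2) := by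
  simpa [mgf] using congrFun (mgf_id_gaussianReal (μ := 0) (v := v)) a

lemma memLp_two_eulerRemainder (μ σ d : ℝ) (v : ℝ≥0) :
    MemLp (eulerRemainder μ σ d) 2 (gaussianReal 0 v) := by
  unfold eulerRemainder
  simp_rw [Real.exp_add]
  exact (((memLp_two_exp_mul_gaussianReal 0 σ v).mul_const _).sub (memLp_const 1)).sub
    (memLp_two_eulerStep μ σ d v)

lemma integral_eulerRemainder (μ σ : ℝ) (d : ℝ≥0) :
    ∫ w, eulerRemainder μ σ d w ∂(gaussianReal 0 d) = Real.exp (μ * d) - 1 - μ * d := by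
  unfold eulerRemainder
  simp_rw [Real.exp_add]
  have hexp := (integrable_exp_mul_gaussianReal (μ := 0) (v := d) σ).mul_const
    (Real.exp ((μ - σ ^ 2 / 2) * d))
  rw [integral_sub (f := fun w ↦ Real.exp (σ * w) * Real.exp ((μ - σ ^ 2 / 2) * d) - 1)
      (hexp.sub (integrable_const 1)) ((memLp_two_eulerStep μ σ d d).integrable one_le_two),
    integral_sub hexp (integrable_const 1), integral_mul_const, integral_exp_mul_gaussianReal_zero,
    integral_eulerStep, ← Real.exp_add]
  simp only [integral_const, probReal_univ, one_smul]
  ring_nf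

lemma gaussianReal_eq_map_sqrt_mul (v : ℝ≥0) :
    gaussianReal 0 v = (gaussianReal 0 1).map (fun z ↦ √v * z) := by
  rw [gaussianReal_map_const_mul, mul_zero, mul_one]
  congr 1
  ext
  simp

lemma abs_mul_sqrt_mul_add_mul_le (σ ν z : ℝ) {d : ℝ} (hd0 : 0 ≤ d) (hd1 : d ≤ 1) :
    |σ * (√d * z) + ν * d| ≤ √d * (|σ| * |z| + |ν|) := by
  have hd : d ≤ √d := Real.le_sqrt_of_sq_le (by nlinarith)
  calc |σ * (√d * z) + ν * d| ≤ |σ * (√d * z)| + |ν * d| := abs_add_le _ _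
    _ = √d * (|σ| * |z|) + |ν| * d := by
      rw [abs_mul, abs_mul, abs_mul, abs_of_nonneg (Real.sqrt_nonneg d), abs_of_nonneg hd0]; ring
    _ ≤ √d * (|σ| * |z|) + |ν| * √d := by gcongr
    _ = _ := by ring

lemma abs_eulerRemainder_sqrt_mul_le (μ σ z : ℝ) {d : ℝ} (hd0 : 0 ≤ d) (hd1 : d ≤ 1) :
    |eulerRemainder μ σ d (√d * z)| ≤
      d * ((2 + σ ^ 2) * Real.exp (2 * (|σ| * |z| + |μ - σ ^ 2 / 2|))) := by
  set q := |σ| * |z| + |μ - σ ^ 2 / 2|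
  set x := σ * (√d * z) + (μ - σ ^ 2 / 2) * d with hx
  have hq0 : 0 ≤ q := by positivity
  have hxq : |x| ≤ √d * q := abs_mul_sqrt_mul_add_mul_le σ _ z hd0 hd1
  have hxq' : |x| ≤ q := hxq.trans (mul_le_of_le_one_left hq0 (Real.sqrt_le_one.2 hd1))
  have hqe : q ^ 2 ≤ 2 * Real.exp q := by nlinarith [Real.quadratic_le_exp_of_nonneg hq0]
  have hx2 : x ^ 2 ≤ d * (2 * Real.exp q) := by
    calc x ^ 2 = |x| ^ 2 := (sq_abs x).symm
      _ ≤ (√d * q) ^ 2 := by gcongr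
      _ = d * q ^ 2 := by rw [mul_pow, Real.sq_sqrt hd0]
      _ ≤ d * (2 * Real.exp q) := by gcongr
  have hsplit : eulerRemainder μ σ d (√d * z) = (Real.exp x - 1 - x) - σ ^ 2 / 2 * d := by
    rw [eulerRemainder, eulerStep, hx]; ring
  calc |eulerRemainder μ σ d (√d * z)|
      ≤ |Real.exp x - 1 - x| + |σ ^ 2 / 2 * d| := by rw [hsplit]; exact abs_sub _ _
    _ ≤ x ^ 2 * Real.exp |x| + σ ^ 2 / 2 * d := by
      rw [abs_of_nonneg (by positivity : 0 ≤ σ ^ 2 / 2 * d)]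
      gcongr
      exact abs_exp_sub_one_sub_le x
    _ ≤ d * (2 * Real.exp q) * Real.exp q + σ ^ 2 / 2 * d := by gcongr
    _ = d * (2 * Real.exp (2 * q) + σ ^ 2 / 2 * 1) := by
      rw [two_mul q, Real.exp_add q q]; ring
    _ ≤ d * (2 * Real.exp (2 * q) + σ ^ 2 * Real.exp (2 * q)) := by
      gcongr
      · exact half_le_self (sq_nonneg σ)
      · exact Real.one_le_exp (by positivity)
    _ = _ := by ring

lemma exists_abs_integral_eulerRemainder_le (μ σ : ℝ) : ∃ K : ℝ, 0 ≤ K ∧ ∀ d : ℝ≥0, d ≤ 1 →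
    |∫ w, eulerRemainder μ σ d w ∂(gaussianReal 0 d)| ≤ K * d ^ 2 := by
  refine ⟨μ ^ 2 * Real.exp |μ|, by positivity, fun d hd ↦ ?_⟩
  have hd' : (d : ℝ) ≤ 1 := by exact_mod_cast hd
  have habs : |μ * d| ≤ |μ| := by
    rw [abs_mul, abs_of_nonneg d.coe_nonneg]
    exact mul_le_of_le_one_right (abs_nonneg μ) hd'
  rw [integral_eulerRemainder]
  calc _ ≤ (μ * d) ^ 2 * Real.exp |μ * d| := abs_exp_sub_one_sub_le _
    _ ≤ (μ * d) ^ 2 * Real.exp |μ| := by gcongr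
    _ = _ := by ring

lemma exists_integral_eulerRemainder_sq_le (μ σ : ℝ) : ∃ K : ℝ, 0 ≤ K ∧ ∀ d : ℝ≥0, d ≤ 1 →
    ∫ w, eulerRemainder μ σ d w ^ 2 ∂(gaussianReal 0 d) ≤ K * d ^ 2 := by
  let bound : ℝ → ℝ := fun z ↦ (2 + σ ^ 2) * Real.exp (2 * (|σ| * |z| + |μ - σ ^ 2 / 2|))
  have hbound z : bound z ^ 2 = (2 + σ ^ 2) ^ 2 *
      (Real.exp (4 * |μ - σ ^ 2 / 2|) * Real.exp (|4 * σ| * |z|)) := by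
    rw [mul_pow, ← Real.exp_nat_mul, ← Real.exp_add, abs_mul, abs_of_pos (four_pos (α := ℝ))]
    congr 2
    push_cast
    ring
  have hint : Integrable (fun z ↦ bound z ^ 2) (gaussianReal 0 1) := by
    simp_rw [hbound]
    exact ((integrable_exp_abs_mul_abs (X := fun z ↦ z) (integrable_exp_mul_gaussianReal (4 * σ))
      (integrable_exp_mul_gaussianReal (-(4 * σ)))).const_mul _).const_mul _
  refine ⟨∫ z, bound z ^ 2 ∂(gaussianReal 0 1), integral_nonneg fun z ↦ sq_nonneg _,
    fun d hd ↦ ?_⟩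
  have hd' : (d : ℝ) ≤ 1 := by exact_mod_cast hd
  calc ∫ w, eulerRemainder μ σ d w ^ 2 ∂(gaussianReal 0 d)
      = ∫ z, eulerRemainder μ σ d (√d * z) ^ 2 ∂(gaussianReal 0 1) := by
        conv_lhs => rw [gaussianReal_eq_map_sqrt_mul]
        rw [integral_map (by fun_prop) (by fun_prop)]
    _ ≤ ∫ z, d ^ 2 * bound z ^ 2 ∂(gaussianReal 0 1) := by
        refine integral_mono_of_nonneg (.of_forall fun z ↦ sq_nonneg _) (hint.const_mul _)
          (.of_forall fun z ↦ ?_)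
        simp only
        rw [← sq_abs, ← mul_pow]
        gcongr
        exact abs_eulerRemainder_sqrt_mul_le μ σ z d.coe_nonneg hd'
    _ = _ := by rw [integral_const_mul, mul_comm]

end EulerStep

/-! ### Continuous paths on a time interval -/

section DenseTimes

/-- An enumeration of a dense set of times in `[0, T]`, used to write events about a continuous
path on `[0, T]` with countably many conditions. -/
noncomputable def denseTime (T : ℝ≥0) (n : ℕ) : ℝ≥0 := min (TopologicalSpace.denseSeq ℝ≥0 n) T

lemma denseTime_le (T : ℝ≥0) (n : ℕ) : denseTime T n ≤ T := min_le_right _ _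

lemma exists_denseTime_mem {T t : ℝ≥0} (ht : t ≤ T) {U : Set ℝ≥0} (hU : IsOpen U) (htU : t ∈ U) :
    ∃ n, denseTime T n ∈ U := by
  have hV : IsOpen ((min · T) ⁻¹' U) := hU.preimage (by fun_prop)
  exact (TopologicalSpace.denseRange_denseSeq ℝ≥0).exists_mem_open hV
    ⟨t, by simpa [min_eq_left ht] using htU⟩

lemma exists_denseTime_eq (T : ℝ≥0) : ∃ n, denseTime T n = T := by
  obtain ⟨n, hn⟩ := (TopologicalSpace.denseRange_denseSeq ℝ≥0).exists_mem_open
    (isOpen_Ioi (a := T)) ⟨T + 1, by simp⟩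
  exact ⟨n, min_eq_right (Set.mem_Ioi.1 hn).le⟩

lemma le_of_forall_denseTime_le {α : Type*} [TopologicalSpace α] [LinearOrder α]
    [OrderClosedTopology α] {f : ℝ≥0 → α} (hf : Continuous f) {T : ℝ≥0} {a : α}
    (h : ∀ n, f (denseTime T n) ≤ a) {t : ℝ≥0} (ht : t ≤ T) : f t ≤ a := by
  by_contra! hlt
  obtain ⟨n, hn⟩ := exists_denseTime_mem ht (isOpen_Ioi.preimage hf) hlt
  exact (h n).not_gt hn

lemma bddAbove_range_Icc {f : ℝ≥0 → ℝ} (hf : Continuous f) (T : ℝ≥0) :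
    BddAbove (Set.range fun t : Set.Icc (0 : ℝ≥0) T ↦ f t) := by
  have h := isCompact_Icc.bddAbove_image (K := Set.Icc 0 T) hf.continuousOn
  rwa [Set.image_eq_range] at h

lemma iSup_Icc_eq_iSup_denseTime {f : ℝ≥0 → ℝ} (hf : Continuous f) (T : ℝ≥0) :
    ⨆ t : Set.Icc (0 : ℝ≥0) T, f t = ⨆ n, f (denseTime T n) := by
  have : Nonempty (Set.Icc (0 : ℝ≥0) T) := ⟨0, le_rfl, zero_le⟩
  have hle n : f (denseTime T n) ≤ ⨆ t : Set.Icc (0 : ℝ≥0) T, f t :=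
    le_ciSup (bddAbove_range_Icc hf T)
      (⟨denseTime T n, zero_le, denseTime_le T n⟩ : Set.Icc (0 : ℝ≥0) T)
  refine le_antisymm (ciSup_le fun t ↦ le_of_forall_denseTime_le hf (fun n ↦ ?_) t.2.2)
    (ciSup_le hle)
  exact le_ciSup (f := fun n ↦ f (denseTime T n)) ⟨_, Set.forall_mem_range.2 hle⟩ n

variable {Ω : Type*} {mΩ : MeasurableSpace Ω} {P : Measure Ω}

lemma aemeasurable_iSup_Icc {Z : ℝ≥0 → Ω → ℝ} (hZ : ∀ t, Measurable (Z t))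
    (hc : ∀ᵐ ω ∂P, Continuous (Z · ω)) (T : ℝ≥0) :
    AEMeasurable (fun ω ↦ ⨆ t : Set.Icc (0 : ℝ≥0) T, Z t ω) P := by
  refine ⟨fun ω ↦ ⨆ n, Z (denseTime T n) ω, Measurable.iSup fun n ↦ hZ _, ?_⟩
  filter_upwards [hc] with ω hω using iSup_Icc_eq_iSup_denseTime hω T

lemma exists_measurable_uncurry_of_ae_continuous {H : ℝ≥0 → Ω → ℝ} (hH : ∀ s, Measurable (H s))
    (hc : ∀ᵐ ω ∂P, Continuous (H · ω)) :
    ∃ H' : ℝ≥0 → Ω → ℝ, Measurable (Function.uncurry H') ∧ ∀ᵐ ω ∂P, ∀ s, H' s ω = H s ω := by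
  obtain ⟨C, hC, hCm, hC0⟩ := exists_measurable_superset_of_null hc
  refine ⟨fun s ↦ Cᶜ.indicator (H s), measurable_uncurry_of_continuous_of_measurable (fun ω ↦ ?_)
    fun s ↦ (hH s).indicator hCm.compl, ?_⟩
  · by_cases hω : ω ∈ C
    · simpa [hω] using continuous_const
    · have hcont : Continuous (H · ω) := by
        by_contra h
        exact hω (hC h)
      simpa [hω] using hcont
  · filter_upwards [measure_eq_zero_iff_ae_notMem.1 hC0] with ω hω s
    exact Set.indicator_of_mem hω _

end DenseTimes

/-! ### Uniform grids -/

section Grid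

/-- The step length of the uniform grid with `n + 1` steps on `[0, t]`. -/
noncomputable def mesh (t : ℝ≥0) (n : ℕ) : ℝ≥0 := t / (n + 1)

/-- The `i`-th point of the uniform grid with `n + 1` steps on `[0, t]`. -/
noncomputable def gridTime (t : ℝ≥0) (n i : ℕ) : ℝ≥0 := i * mesh t n

lemma succ_mul_mesh (t : ℝ≥0) (n : ℕ) : (n + 1) * mesh t n = t :=
  mul_div_cancel₀ _ (by positivity)

lemma mesh_le (t : ℝ≥0) (n : ℕ) : mesh t n ≤ t :=
  div_le_self zero_le (by simp)

lemma tendsto_mesh (t : ℝ≥0) : Tendsto (fun n ↦ (mesh t n : ℝ)) atTop (𝓝 0) :=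
  (tendsto_const_div_atTop_nhds_zero_nat (t : ℝ)).comp (tendsto_add_atTop_nat 1) |>.congr
    fun n ↦ by simp [mesh]

@[simp]
lemma gridTime_zero (t : ℝ≥0) (n : ℕ) : gridTime t n 0 = 0 := by simp [gridTime]

@[simp]
lemma gridTime_last (t : ℝ≥0) (n : ℕ) : gridTime t n (n + 1) = t := by
  rw [gridTime, Nat.cast_add_one, succ_mul_mesh]

lemma gridTime_succ (t : ℝ≥0) (n i : ℕ) : gridTime t n (i + 1) = gridTime t n i + mesh t n := by
  rw [gridTime, gridTime, Nat.cast_add_one, add_one_mul]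

lemma coe_gridTime_succ_sub (t : ℝ≥0) (n i : ℕ) :
    (gridTime t n (i + 1) : ℝ) - gridTime t n i = mesh t n := by
  rw [gridTime_succ, NNReal.coe_add, add_sub_cancel_left]

lemma monotone_gridTime (t : ℝ≥0) (n : ℕ) : Monotone (gridTime t n) :=
  monotone_nat_of_le_succ fun i ↦ by rw [gridTime_succ]; exact le_self_add

lemma gridTime_le {t : ℝ≥0} {n i : ℕ} (hi : i ≤ n + 1) : gridTime t n i ≤ t :=
  (monotone_gridTime t n hi).trans_eq (gridTime_last t n)

lemma eventually_grid_osc_le {f : ℝ≥0 → ℝ} (hf : Continuous f) (t : ℝ≥0) {ε : ℝ} (hε : 0 < ε) :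
    ∀ᶠ n : ℕ in atTop, ∀ i < n + 1, ∀ s ∈ Set.Icc (gridTime t n i) (gridTime t n (i + 1)),
      |f (gridTime t n i) - f s| ≤ ε := by
  obtain ⟨δ, hδ, h⟩ := Metric.uniformContinuousOn_iff.1
    (isCompact_Icc.uniformContinuousOn_of_continuous (s := Set.Icc 0 t) hf.continuousOn) ε hε
  filter_upwards [(tendsto_mesh t).eventually_lt_const hδ] with n hn i hi s hs
  refine (h (gridTime t n i) ⟨zero_le, gridTime_le hi.le⟩ s
    ⟨zero_le, hs.2.trans (gridTime_le hi)⟩ (lt_of_le_of_lt ?_ hn)).le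
  have hleft : (gridTime t n i : ℝ) ≤ s := hs.1
  have hright : (s : ℝ) ≤ gridTime t n (i + 1) := hs.2
  rw [NNReal.dist_eq, abs_sub_comm, abs_of_nonneg (sub_nonneg.2 hleft),
    ← coe_gridTime_succ_sub t n i]
  linarith

lemma exists_mem_grid_cell {t s : ℝ≥0} (n : ℕ) (hs0 : 0 < s) (hst : s ≤ t) :
    ∃ i < n + 1, s ∈ Set.Ioc (gridTime t n i) (gridTime t n (i + 1)) := by
  have hmem : s ∈ Set.Ioc (gridTime t n 0) (gridTime t n (n + 1)) := by simp [hs0, hst]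
  rw [← (monotone_gridTime t n).biUnion_Ico_Ioc_map_succ] at hmem
  simpa only [Set.mem_iUnion, Set.mem_Ico, zero_le, true_and, exists_prop,
    Nat.succ_eq_succ] using hmem

lemma sum_indicator_Ioc_eq {M : Type*} [AddCommMonoid M] {τ : ℕ → ℝ≥0} (hτ : Monotone τ)
    {s : ℝ≥0} {n i : ℕ} (hi : i < n) (hs : s ∈ Set.Ioc (τ i) (τ (i + 1))) (a : ℕ → M) :
    ∑ j ∈ Finset.range n, (Set.Ioc (τ j) (τ (j + 1))).indicator (fun _ ↦ a j) s = a i := by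
  rw [Finset.sum_eq_single_of_mem i (Finset.mem_range.2 hi), Set.indicator_of_mem hs]
  exact fun j _ hji ↦ Set.indicator_of_notMem
    (fun hj ↦ Set.disjoint_left.1 (hτ.pairwise_disjoint_on_Ioc_succ hji) hj hs) _

lemma sum_integral_grid_cells {f : ℝ≥0 → ℝ} (hf : Continuous f) (t : ℝ≥0) (n : ℕ) :
    ∑ i ∈ Finset.range (n + 1),
      ∫ s in (gridTime t n i : ℝ)..gridTime t n (i + 1), f s.toNNReal
      = ∫ s in (0 : ℝ)..t, f s.toNNReal := by
  have hcont : Continuous fun s : ℝ ↦ f s.toNNReal := hf.comp continuous_real_toNNReal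
  rw [intervalIntegral.sum_integral_adjacent_intervals (a := fun i ↦ (gridTime t n i : ℝ))
    fun k _ ↦ hcont.intervalIntegrable _ _]
  simp only [gridTime_zero, gridTime_last, NNReal.coe_zero]

lemma abs_mul_mesh_sub_integral_le {f : ℝ≥0 → ℝ} (hf : Continuous f) {t : ℝ≥0} {n i : ℕ} {ε : ℝ}
    (h : ∀ s ∈ Set.Icc (gridTime t n i) (gridTime t n (i + 1)), |f (gridTime t n i) - f s| ≤ ε) :
    |f (gridTime t n i) * mesh t n -
      ∫ s in (gridTime t n i : ℝ)..gridTime t n (i + 1), f s.toNNReal| ≤ ε * mesh t n := by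
  have hle : (gridTime t n i : ℝ) ≤ gridTime t n (i + 1) := monotone_gridTime t n i.le_succ
  have hcont : Continuous fun s : ℝ ↦ f s.toNNReal := hf.comp continuous_real_toNNReal
  have hconst : f (gridTime t n i) * mesh t n =
      ∫ _ in (gridTime t n i : ℝ)..gridTime t n (i + 1), f (gridTime t n i) := by
    rw [intervalIntegral.integral_const, coe_gridTime_succ_sub, smul_eq_mul, mul_comm]
  rw [hconst, ← intervalIntegral.integral_sub intervalIntegrable_const
    (hcont.intervalIntegrable _ _), ← Real.norm_eq_abs]
  refine (intervalIntegral.norm_integral_le_of_norm_le_const fun _ hs ↦ h _ ?_).trans_eq ?_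
  · rw [Set.uIoc_of_le hle] at hs
    exact ⟨NNReal.le_toNNReal_of_coe_le hs.1.le, Real.toNNReal_le_iff_le_coe.2 hs.2⟩
  · rw [coe_gridTime_succ_sub, NNReal.abs_eq]

lemma tendsto_grid_riemann_sum {f : ℝ≥0 → ℝ} (hf : Continuous f) (t : ℝ≥0) :
    Tendsto (fun n : ℕ ↦ ∑ i ∈ Finset.range (n + 1), f (gridTime t n i) * mesh t n)
      atTop (𝓝 (∫ s in (0 : ℝ)..t, f s.toNNReal)) := by
  rw [Metric.tendsto_nhds]
  intro ε hε
  filter_upwards [eventually_grid_osc_le hf t (by positivity : 0 < ε / (t + 1))] with n hn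
  rw [← sum_integral_grid_cells hf t n, Real.dist_eq, ← Finset.sum_sub_distrib]
  calc |∑ i ∈ Finset.range (n + 1), (f (gridTime t n i) * mesh t n -
        ∫ s in (gridTime t n i : ℝ)..gridTime t n (i + 1), f s.toNNReal)|
      ≤ ∑ i ∈ Finset.range (n + 1), ε / (t + 1) * mesh t n :=
        (Finset.abs_sum_le_sum_abs _ _).trans <| Finset.sum_le_sum fun i hi ↦
          abs_mul_mesh_sub_integral_le hf (hn i (Finset.mem_range.1 hi))
    _ = ε / (t + 1) * ((n + 1) * mesh t n : ℝ≥0) := by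
        rw [Finset.sum_const, Finset.card_range, nsmul_eq_mul]
        push_cast
        ring
    _ < ε / (t + 1) * (t + 1) := by
        rw [succ_mul_mesh]
        gcongr
        exact lt_add_one _
    _ = ε := div_mul_cancel₀ _ (by positivity)

end Grid

/-! ### Step approximation of a continuous adapted process -/

section GridProcess

variable {Ω : Type*} {mΩ : MeasurableSpace Ω} {𝓕 : Filtration ℝ≥0 mΩ} {H : ℝ≥0 → Ω → ℝ}

/-- The elementary process that samples an adapted process at the left grid points. -/
noncomputable def gridProcess (H : ℝ≥0 → Ω → ℝ) (hH : Adapted 𝓕 H) (t : ℝ≥0) (n : ℕ) :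
    ElementaryProcess 𝓕 where
  k := n + 1
  time := gridTime t n
  mono := monotone_gridTime t n
  ξ i := H (gridTime t n i)
  meas _ := hH _

lemma gridProcess_integral (hH : Adapted 𝓕 H) (t : ℝ≥0) (n : ℕ) (W : ℝ≥0 → Ω → ℝ) (ω : Ω) :
    (gridProcess H hH t n).integral W t ω = ∑ i ∈ Finset.range (n + 1),
      H (gridTime t n i) ω * (W (gridTime t n (i + 1)) ω - W (gridTime t n i) ω) := by
  refine Finset.sum_congr rfl fun i hi ↦ ?_
  have hi' : i < n + 1 := Finset.mem_range.1 hi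
  simp only [gridProcess, min_eq_left (gridTime_le hi'.le), min_eq_left (gridTime_le hi')]

lemma measurable_elementaryProcess_value (S : ElementaryProcess 𝓕) :
    Measurable fun p : Ω × ℝ ↦ S.value p.2.toNNReal p.1 := by
  refine Finset.measurable_fun_sum _ fun i _ ↦ ?_
  exact Measurable.indicator (f := fun p : Ω × ℝ ↦ S.ξ i p.1)
    (((S.meas i).mono (𝓕.le _) le_rfl).comp measurable_fst)
    (measurableSet_Ioc.preimage (measurable_real_toNNReal.comp measurable_snd))

lemma aemeasurable_lintegral_sq_value_sub {P : Measure Ω} (S : ElementaryProcess 𝓕)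
    (hH : ∀ s, Measurable (H s)) (hc : ∀ᵐ ω ∂P, Continuous (H · ω)) (t : ℝ≥0) :
    AEMeasurable (fun ω ↦ ∫⁻ s in Set.Ioc (0 : ℝ) t,
      ENNReal.ofReal ((S.value s.toNNReal ω - H s.toNNReal ω) ^ 2)) P := by
  obtain ⟨H', hH', heq⟩ := exists_measurable_uncurry_of_ae_continuous hH hc
  refine ⟨fun ω ↦ ∫⁻ s in Set.Ioc (0 : ℝ) t,
    ENNReal.ofReal ((S.value s.toNNReal ω - H' s.toNNReal ω) ^ 2), ?_, ?_⟩
  · refine Measurable.lintegral_prod_right' (f := fun p : Ω × ℝ ↦ ENNReal.ofReal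
      ((S.value p.2.toNNReal p.1 - H' p.2.toNNReal p.1) ^ 2)) ?_
    refine (((measurable_elementaryProcess_value S).sub ?_).pow_const 2).ennreal_ofReal
    exact hH'.comp (f := fun p : Ω × ℝ ↦ (p.2.toNNReal, p.1)) (by fun_prop)
  · filter_upwards [heq] with ω hω
    simp only [hω]

lemma tendsto_lintegral_sq_gridProcess_sub (hH : Adapted 𝓕 H) {ω : Ω} (hω : Continuous (H · ω))
    (t : ℝ≥0) :
    Tendsto (fun n ↦ ∫⁻ s in Set.Ioc (0 : ℝ) t,
      ENNReal.ofReal (((gridProcess H hH t n).value s.toNNReal ω - H s.toNNReal ω) ^ 2))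
      atTop (𝓝 0) := by
  have hbound : Tendsto (fun δ : ℝ ↦ ENNReal.ofReal (δ ^ 2 * t)) (𝓝[>] 0) (𝓝 0) := by
    have hcont : Continuous fun δ : ℝ ↦ ENNReal.ofReal (δ ^ 2 * t) :=
      ENNReal.continuous_ofReal.comp (by fun_prop)
    simpa using (hcont.tendsto 0).mono_left (nhdsWithin_le_nhds (s := Set.Ioi 0))
  rw [ENNReal.tendsto_nhds_zero]
  intro ε hε
  obtain ⟨δ, hδε, hδ⟩ := ((hbound.eventually_le_const hε).and self_mem_nhdsWithin).exists
  filter_upwards [eventually_grid_osc_le hω t hδ] with n hn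
  calc _ ≤ ∫⁻ s in Set.Ioc (0 : ℝ) t, ENNReal.ofReal (δ ^ 2) := by
        refine setLIntegral_mono' measurableSet_Ioc fun s hs ↦ ENNReal.ofReal_le_ofReal ?_
        obtain ⟨i, hi, his⟩ := exists_mem_grid_cell (t := t) (s := s.toNNReal) n
          (Real.toNNReal_pos.2 hs.1) (Real.toNNReal_le_iff_le_coe.2 hs.2)
        have hval : (gridProcess H hH t n).value s.toNNReal ω = H (gridTime t n i) ω :=
          sum_indicator_Ioc_eq (monotone_gridTime t n) hi his fun j ↦ H (gridTime t n j) ω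
        rw [hval, ← sq_abs]
        gcongr
        exact hn i hi _ ⟨his.1.le, his.2⟩
    _ = ENNReal.ofReal (δ ^ 2 * t) := by simp [ENNReal.ofReal_mul (sq_nonneg δ)]
    _ ≤ ε := hδε

lemma tendsto_measure_le_of_ae_tendsto_zero {P : Measure Ω} [IsFiniteMeasure P]
    {f : ℕ → Ω → ℝ≥0∞} (hf : ∀ n, AEMeasurable (f n) P)
    (hlim : ∀ᵐ ω ∂P, Tendsto (f · ω) atTop (𝓝 0)) {ε : ℝ≥0∞} (hε : 0 < ε) :
    Tendsto (fun n ↦ P {ω | ε ≤ f n ω}) atTop (𝓝 0) := by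
  have hmk : ∀ᵐ ω ∂P, ∀ n, f n ω = (hf n).mk (f n) ω := ae_all_iff.2 fun n ↦ (hf n).ae_eq_mk
  have h := tendsto_measure_of_ae_tendsto_indicator_of_isFiniteMeasure (μ := P) (L := atTop)
    (A := ∅) (As := fun n ↦ {ω | ε ≤ (hf n).mk (f n) ω}) .empty
    (fun n ↦ measurableSet_le measurable_const (hf n).measurable_mk) ?_
  · rw [measure_empty] at h
    refine h.congr fun n ↦ measure_congr ?_
    filter_upwards [hmk] with ω hω
    exact congrArg (ε ≤ ·) (hω n).symm
  · filter_upwards [hmk, hlim] with ω hω hω0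
    filter_upwards [hω0.eventually_lt_const hε] with n hn
    simpa only [Set.mem_ofPred_eq, ← hω n, Set.mem_empty_iff_false, iff_false, not_le] using hn

lemma approximatesOn_gridProcess {P : Measure Ω} [IsFiniteMeasure P] (hH : Adapted 𝓕 H)
    (hc : ∀ᵐ ω ∂P, Continuous (H · ω)) (t : ℝ≥0) :
    ApproximatesOn (gridProcess H hH t) H t P := by
  intro ε hε
  refine tendsto_measure_le_of_ae_tendsto_zero (fun n ↦ aemeasurable_lintegral_sq_value_sub _
    (fun s ↦ (hH s).mono (𝓕.le s) le_rfl) hc t) ?_ hε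
  filter_upwards [hc] with ω hω using tendsto_lintegral_sq_gridProcess_sub hH hω t

end GridProcess

/-! ### Sums over Brownian grid increments -/

section GridSum

variable {Ω : Type*} {mΩ : MeasurableSpace Ω} {𝓕 : Filtration ℝ≥0 mΩ} {P : Measure Ω}
  {W Z : ℝ≥0 → Ω → ℝ} {φ : ℝ → ℝ}

/-- The increment of a process over the `i`-th cell of the uniform grid on `[0, t]`. -/
noncomputable def gridIncrement (W : ℝ≥0 → Ω → ℝ) (t : ℝ≥0) (n i : ℕ) (ω : Ω) : ℝ :=
  W (gridTime t n (i + 1)) ω - W (gridTime t n i) ω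

/-- The sum over the cells of the uniform grid on `[0, t]` of the left value of `Z` times a function
`φ` of the increment of `W`. -/
noncomputable def gridSum (φ : ℝ → ℝ) (W Z : ℝ≥0 → Ω → ℝ) (t : ℝ≥0) (n : ℕ) (ω : Ω) : ℝ :=
  ∑ i ∈ Finset.range (n + 1), Z (gridTime t n i) ω * φ (gridIncrement W t n i ω)

/-- The Euler sum for `∫ μ Z ds + ∫ σ Z dW` on a uniform grid of `[0, t]`. -/
noncomputable def eulerSum (μ σ : ℝ) (W Z : ℝ≥0 → Ω → ℝ) (t : ℝ≥0) (n : ℕ) : Ω → ℝ :=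
  gridSum (eulerStep μ σ (mesh t n)) W Z t n

lemma eulerSum_eq_add (μ σ : ℝ) (W Z : ℝ≥0 → Ω → ℝ) (t : ℝ≥0) (n : ℕ) (ω : Ω) :
    eulerSum μ σ W Z t n ω =
      ∑ i ∈ Finset.range (n + 1), μ * Z (gridTime t n i) ω * mesh t n +
      ∑ i ∈ Finset.range (n + 1), σ * Z (gridTime t n i) ω * gridIncrement W t n i ω := by
  rw [eulerSum, gridSum, ← Finset.sum_add_distrib]
  refine Finset.sum_congr rfl fun i _ ↦ ?_
  rw [eulerStep]
  ring

lemma eulerSum_sub (μ σ : ℝ) (W Z Z' : ℝ≥0 → Ω → ℝ) (t : ℝ≥0) (n : ℕ) (ω : Ω) :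
    eulerSum μ σ W (Z - Z') t n ω = eulerSum μ σ W Z t n ω - eulerSum μ σ W Z' t n ω := by
  simp only [eulerSum, gridSum, ← Finset.sum_sub_distrib, Pi.sub_apply, sub_mul]

lemma hasLaw_gridIncrement (hW : IsBrownianReal W P) (t : ℝ≥0) (n i : ℕ) :
    HasLaw (gridIncrement W t n i) (gaussianReal 0 (mesh t n)) P := by
  have hdist : nndist (gridTime t n (i + 1) : ℝ) (gridTime t n i) = mesh t n := by
    ext
    rw [coe_nndist, Real.dist_eq, coe_gridTime_succ_sub, NNReal.abs_eq]
  rw [← hdist]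
  exact hW.hasLaw_sub (gridTime t n (i + 1)) (gridTime t n i)

lemma memLp_comp_gridIncrement (hW : IsBrownianReal W P) (t : ℝ≥0) (n i : ℕ) {p : ℝ≥0∞}
    (hφ : MemLp φ p (gaussianReal 0 (mesh t n))) :
    MemLp (fun ω ↦ φ (gridIncrement W t n i ω)) p P := by
  have hlaw := hasLaw_gridIncrement hW t n i
  rw [← hlaw.map_eq] at hφ
  exact hφ.comp_of_map hlaw.aemeasurable

namespace IsBrownianWrt

lemma indep_comp_gridIncrement (hW : IsBrownianWrt 𝓕 W P) (t : ℝ≥0) (n i : ℕ)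
    (hφ : Measurable φ) :
    Indep (MeasurableSpace.comap (fun ω ↦ φ (gridIncrement W t n i ω)) inferInstance)
      (𝓕 (gridTime t n i)) P :=
  indep_of_indep_of_le_left (hW.indep _ _ (monotone_gridTime t n i.le_succ))
    (hφ.comp (comap_measurable (gridIncrement W t n i))).comap_le

lemma measurable_comp_gridIncrement (hW : IsBrownianWrt 𝓕 W P) (t : ℝ≥0) (n i : ℕ)
    (hφ : Measurable φ) :
    Measurable[𝓕 (gridTime t n (i + 1))] fun ω ↦ φ (gridIncrement W t n i ω) :=
  hφ.comp <| Measurable.sub (hW.adapted _) <|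
    (hW.adapted _).mono (𝓕.mono (monotone_gridTime t n i.le_succ)) le_rfl

lemma measurable_gridSum (hW : IsBrownianWrt 𝓕 W P) (hZ : Adapted 𝓕 Z) (t : ℝ≥0) (n : ℕ)
    (hφ : Measurable φ) : Measurable (gridSum φ W Z t n) :=
  Finset.measurable_fun_sum _ fun i _ ↦ ((hZ _).mono (𝓕.le _) le_rfl).mul
    ((hW.measurable_comp_gridIncrement t n i hφ).mono (𝓕.le _) le_rfl)

lemma memLp_two_gridSum (hW : IsBrownianWrt 𝓕 W P) (hZ : Adapted 𝓕 Z)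
    (hZ2 : ∀ s, MemLp (Z s) 2 P) (t : ℝ≥0) (n : ℕ) (hφ : Measurable φ)
    (hφ2 : MemLp φ 2 (gaussianReal 0 (mesh t n))) : MemLp (gridSum φ W Z t n) 2 P :=
  memLp_finsetSum _ fun i _ ↦ memLp_two_mul_of_indepFun (hZ2 _)
    (memLp_comp_gridIncrement hW.isBrownian t n i hφ2)
    (indepFun_of_measurable_of_indep (hZ _) (hW.indep_comp_gridIncrement t n i hφ))

lemma integral_gridSum_sq_le [IsProbabilityMeasure P] (hW : IsBrownianWrt 𝓕 W P)
    (hZ : Adapted 𝓕 Z) (hZ2 : ∀ s, MemLp (Z s) 2 P) (t : ℝ≥0) (n : ℕ) (hφ : Measurable φ)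
    (hφ2 : MemLp φ 2 (gaussianReal 0 (mesh t n))) :
    ∫ ω, gridSum φ W Z t n ω ^ 2 ∂P ≤
      2 * (∫ w, φ w ^ 2 ∂(gaussianReal 0 (mesh t n)) +
        (n + 1) * (∫ w, φ w ∂(gaussianReal 0 (mesh t n))) ^ 2) *
        ∑ i ∈ Finset.range (n + 1), ∫ ω, Z (gridTime t n i) ω ^ 2 ∂P := by
  have hlaw i := hasLaw_gridIncrement hW.isBrownian t n i
  simpa only [gridSum, Nat.cast_add_one] using
    integral_sq_sum_mul_le (𝓖 := fun i ↦ 𝓕 (gridTime t n i))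
      (η := fun i ω ↦ φ (gridIncrement W t n i ω))
      (fun i j hij ↦ 𝓕.mono (monotone_gridTime t n hij)) (fun i ↦ hZ _)
      (fun i ↦ hW.measurable_comp_gridIncrement t n i hφ) (fun i ↦ hZ2 _)
      (fun i ↦ memLp_comp_gridIncrement hW.isBrownian t n i hφ2)
      (fun i ↦ hW.indep_comp_gridIncrement t n i hφ)
      (fun i ↦ (hlaw i).integral_comp hφ.aestronglyMeasurable)
      (fun i ↦ ((hlaw i).integral_comp (f := fun w ↦ φ w ^ 2)
        (hφ.pow_const 2).aestronglyMeasurable).le) (n + 1)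

lemma integral_eulerSum_sq_le [IsProbabilityMeasure P] (hW : IsBrownianWrt 𝓕 W P)
    (hZ : Adapted 𝓕 Z) (hZ2 : ∀ s, MemLp (Z s) 2 P) (μ σ : ℝ) {t T : ℝ≥0} (ht : t ≤ T) (n : ℕ) :
    ∫ ω, eulerSum μ σ W Z t n ω ^ 2 ∂P ≤ 2 * (2 * μ ^ 2 * T + σ ^ 2) *
      (mesh t n * ∑ i ∈ Finset.range (n + 1), ∫ ω, Z (gridTime t n i) ω ^ 2 ∂P) := by
  set S := ∑ i ∈ Finset.range (n + 1), ∫ ω, Z (gridTime t n i) ω ^ 2 ∂P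
  have _ : 0 ≤ S := Finset.sum_nonneg fun i _ ↦ integral_nonneg fun ω ↦ sq_nonneg _
  have hmesh : (mesh t n : ℝ) ≤ T := (mesh_le t n).trans ht
  have hsum : ((n : ℝ) + 1) * mesh t n = t := mod_cast succ_mul_mesh t n
  have ht' : (t : ℝ) ≤ T := ht
  have hL2 := hW.integral_gridSum_sq_le hZ hZ2 t n (measurable_eulerStep μ σ (mesh t n))
    (memLp_two_eulerStep μ σ _ _)
  rw [integral_eulerStep_sq, integral_eulerStep] at hL2
  calc _ ≤ _ := hL2
    _ = 2 * (μ ^ 2 * mesh t n + μ ^ 2 * ((n + 1) * mesh t n) + σ ^ 2) * (mesh t n * S) := by ring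
    _ ≤ 2 * (μ ^ 2 * T + μ ^ 2 * T + σ ^ 2) * (mesh t n * S) := by rw [hsum]; gcongr
    _ = _ := by ring

end IsBrownianWrt

end GridSum

/-! ### The explicit geometric Brownian motion solves the equation -/

section ExplicitSolution

variable {Ω : Type*} {mΩ : MeasurableSpace Ω} {𝓕 : Filtration ℝ≥0 mΩ} {P : Measure Ω}
  {W : ℝ≥0 → Ω → ℝ}

/-- The explicit geometric Brownian motion driven by `W`. -/
noncomputable def gbm (μ σ : ℝ) (W : ℝ≥0 → Ω → ℝ) (t : ℝ≥0) (ω : Ω) : ℝ :=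
  Real.exp (σ * W t ω + (μ - σ ^ 2 / 2) * t)

lemma continuous_gbm {ω : Ω} (hω : Continuous (W · ω)) (μ σ : ℝ) :
    Continuous (gbm μ σ W · ω) := by
  unfold gbm
  fun_prop

lemma adapted_gbm (hW : Adapted 𝓕 W) (μ σ : ℝ) : Adapted 𝓕 (gbm μ σ W) := fun t ↦
  (((hW t).const_mul σ).add_const _).exp

lemma memLp_two_gbm (hW : IsBrownianReal W P) (μ σ : ℝ) (s : ℝ≥0) :
    MemLp (gbm μ σ W s) 2 P := by
  have hlaw := hW.hasLaw_eval s
  have hexp := memLp_two_exp_mul_gaussianReal 0 σ s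
  rw [← hlaw.map_eq] at hexp
  unfold gbm
  simp_rw [Real.exp_add]
  exact (hexp.comp_of_map hlaw.aemeasurable).mul_const _

lemma integral_gbm_sq (hW : IsBrownianReal W P) (μ σ : ℝ) (s : ℝ≥0) :
    ∫ ω, gbm μ σ W s ω ^ 2 ∂P = Real.exp ((2 * μ + σ ^ 2) * s) := by
  have hsq ω : gbm μ σ W s ω ^ 2 =
      Real.exp (2 * σ * W s ω) * Real.exp (2 * (μ - σ ^ 2 / 2) * s) := by
    rw [gbm, ← Real.exp_nat_mul, ← Real.exp_add]
    push_cast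
    ring_nf
  have hmgf : ∫ ω, Real.exp (2 * σ * W s ω) ∂P = Real.exp (s * (2 * σ) ^ 2 / 2) := by
    rw [← integral_exp_mul_gaussianReal_zero]
    exact (hW.hasLaw_eval s).integral_comp (f := fun w ↦ Real.exp (2 * σ * w)) (by fun_prop)
  simp_rw [hsq]
  rw [integral_mul_const, hmgf, ← Real.exp_add]
  ring_nf

lemma gbm_gridTime_succ_sub (μ σ : ℝ) (W : ℝ≥0 → Ω → ℝ) (t : ℝ≥0) (n i : ℕ) (ω : Ω) :
    gbm μ σ W (gridTime t n (i + 1)) ω - gbm μ σ W (gridTime t n i) ω =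
      gbm μ σ W (gridTime t n i) ω * eulerStep μ σ (mesh t n) (gridIncrement W t n i ω) +
      gbm μ σ W (gridTime t n i) ω * eulerRemainder μ σ (mesh t n) (gridIncrement W t n i ω) := by
  have hstep : gbm μ σ W (gridTime t n (i + 1)) ω = gbm μ σ W (gridTime t n i) ω *
      Real.exp (σ * gridIncrement W t n i ω + (μ - σ ^ 2 / 2) * mesh t n) := by
    rw [gbm, gbm, ← Real.exp_add, gridIncrement, ← coe_gridTime_succ_sub t n i]
    ring_nf
  rw [hstep, eulerRemainder]
  ring

lemma gbm_sub_one_sub_eulerSum {ω : Ω} (h0 : W 0 ω = 0) (μ σ : ℝ) (t : ℝ≥0) (n : ℕ) :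
    gbm μ σ W t ω - 1 - eulerSum μ σ W (gbm μ σ W) t n ω =
      gridSum (eulerRemainder μ σ (mesh t n)) W (gbm μ σ W) t n ω := by
  have hzero : gbm μ σ W 0 ω = 1 := by simp [gbm, h0]
  have htel := Finset.sum_range_sub (fun i ↦ gbm μ σ W (gridTime t n i) ω) (n + 1)
  simp only [gridTime_last, gridTime_zero, hzero, gbm_gridTime_succ_sub,
    Finset.sum_add_distrib] at htel
  rw [← htel]
  exact add_sub_cancel_left _ _

lemma sum_integral_gbm_sq_le (hW : IsBrownianReal W P) (μ σ : ℝ) (t : ℝ≥0) (n : ℕ) :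
    ∑ i ∈ Finset.range (n + 1), ∫ ω, gbm μ σ W (gridTime t n i) ω ^ 2 ∂P ≤
      (n + 1) * Real.exp (|2 * μ + σ ^ 2| * t) := by
  refine (Finset.sum_le_card_nsmul _ _ (Real.exp (|2 * μ + σ ^ 2| * t)) fun i hi ↦ ?_).trans_eq
    (by simp)
  rw [integral_gbm_sq hW]
  gcongr
  · exact le_abs_self _
  · exact gridTime_le (Finset.mem_range.1 hi).le

lemma exists_integral_gbm_sub_eulerSum_sq_le [IsProbabilityMeasure P]
    (hW : IsBrownianWrt 𝓕 W P) (μ σ : ℝ) (t : ℝ≥0) : ∃ K : ℝ, ∀ n, mesh t n ≤ 1 →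
      ∫ ω, (gbm μ σ W t ω - 1 - eulerSum μ σ W (gbm μ σ W) t n ω) ^ 2 ∂P ≤ K * mesh t n := by
  obtain ⟨K₁, _, hK₁⟩ := exists_abs_integral_eulerRemainder_le μ σ
  obtain ⟨K₂, hK₂0, hK₂⟩ := exists_integral_eulerRemainder_sq_le μ σ
  set M := Real.exp (|2 * μ + σ ^ 2| * t)
  refine ⟨2 * (K₂ * t + K₁ ^ 2 * t ^ 2) * M, fun n hn ↦ ?_⟩
  have hsum : ((n : ℝ) + 1) * mesh t n = t := mod_cast succ_mul_mesh t n
  set d : ℝ := (mesh t n : ℝ)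
  have _ : 0 ≤ d := (mesh t n).coe_nonneg
  have _ : d ≤ 1 := hn
  have herror : ∫ ω, (gbm μ σ W t ω - 1 - eulerSum μ σ W (gbm μ σ W) t n ω) ^ 2 ∂P =
      ∫ ω, gridSum (eulerRemainder μ σ d) W (gbm μ σ W) t n ω ^ 2 ∂P := by
    refine integral_congr_ae ?_
    filter_upwards [hW.isBrownian.eval_zero_ae_eq_zero] with ω hω
    rw [gbm_sub_one_sub_eulerSum hω]
  have hmean : (∫ w, eulerRemainder μ σ d w ∂gaussianReal 0 (mesh t n)) ^ 2 ≤
      (K₁ * d ^ 2) ^ 2 := by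
    rw [← sq_abs]
    gcongr
    exact hK₁ _ hn
  calc _ = _ := herror
    _ ≤ _ := hW.integral_gridSum_sq_le (adapted_gbm hW.adapted μ σ)
      (memLp_two_gbm hW.isBrownian μ σ) t n (measurable_eulerRemainder μ σ _)
      (memLp_two_eulerRemainder μ σ _ _)
    _ ≤ 2 * (K₂ * d ^ 2 + (n + 1) * (K₁ * d ^ 2) ^ 2) * ((n + 1) * M) := by
      gcongr
      · exact hK₂ _ hn
      · exact sum_integral_gbm_sq_le hW.isBrownian μ σ t n
    _ = 2 * (K₂ * ((n + 1) * d) + K₁ ^ 2 * ((n + 1) * d) ^ 2 * d) * M * d := by ring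
    _ ≤ 2 * (K₂ * t + K₁ ^ 2 * t ^ 2 * 1) * M * d := by rw [hsum]; gcongr
    _ = _ := by ring

lemma tendstoInMeasure_of_tendsto_integral_sq [IsFiniteMeasure P] {f : ℕ → Ω → ℝ} {g : Ω → ℝ}
    (hInt : ∀ n, Integrable (fun ω ↦ (g ω - f n ω) ^ 2) P)
    (hlim : Tendsto (fun n ↦ ∫ ω, (g ω - f n ω) ^ 2 ∂P) atTop (𝓝 0)) :
    TendstoInMeasure P f atTop g := by
  rw [tendstoInMeasure_iff_measureReal_norm]
  intro ε hε
  refine squeeze_zero (fun n ↦ measureReal_nonneg) (fun n ↦ ?_)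
    (by simpa only [zero_div] using hlim.div_const (ε ^ 2))
  rw [le_div_iff₀ (by positivity), mul_comm]
  refine (mul_le_mul_of_nonneg_left (measureReal_mono fun ω hω ↦ ?_) (sq_nonneg ε)).trans
    (mul_meas_ge_le_integral_of_nonneg (.of_forall fun ω ↦ sq_nonneg _) (hInt n) (ε ^ 2))
  simp only [Set.mem_ofPred_eq, Real.norm_eq_abs] at hω ⊢
  rw [← sq_abs (g ω - f n ω), abs_sub_comm]
  gcongr

lemma tendstoInMeasure_eulerSum_gbm [IsProbabilityMeasure P] (hW : IsBrownianWrt 𝓕 W P)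
    (μ σ : ℝ) (t : ℝ≥0) :
    TendstoInMeasure P (eulerSum μ σ W (gbm μ σ W) t) atTop (fun ω ↦ gbm μ σ W t ω - 1) := by
  obtain ⟨K, hK⟩ := exists_integral_gbm_sub_eulerSum_sq_le hW μ σ t
  have hgbm2 := memLp_two_gbm hW.isBrownian μ σ
  have heuler n : MemLp (eulerSum μ σ W (gbm μ σ W) t n) 2 P :=
    hW.memLp_two_gridSum (adapted_gbm hW.adapted μ σ) hgbm2 t n (by fun_prop)
      (memLp_two_eulerStep μ σ _ _)
  refine tendstoInMeasure_of_tendsto_integral_sq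
    (fun n ↦ (((hgbm2 t).sub (memLp_const 1)).sub (heuler n)).integrable_sq)
    (squeeze_zero' (.of_forall fun n ↦ integral_nonneg fun ω ↦ sq_nonneg _) ?_
      (by simpa only [mul_zero] using (tendsto_mesh t).const_mul K))
  filter_upwards [(tendsto_mesh t).eventually_le_const one_pos] with n hn using hK n hn

end ExplicitSolution

/-! ### Pathwise uniqueness -/

section Uniqueness

variable {Ω : Type*} {mΩ : MeasurableSpace Ω} {𝓕 : Filtration ℝ≥0 mΩ} {P : Measure Ω}
  {W X D : ℝ≥0 → Ω → ℝ} {μ σ : ℝ}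

lemma IsGeometricBrownianMotion.exists_seq_tendsto_eulerSum [IsProbabilityMeasure P]
    (hX : IsGeometricBrownianMotion 𝓕 W P μ σ X) (hW : IsBrownianWrt 𝓕 W P) (t : ℝ≥0) :
    ∃ ns : ℕ → ℕ, ∀ᵐ ω ∂P, Tendsto (fun k ↦ eulerSum μ σ W (X - gbm μ σ W) t (ns k) ω) atTop
      (𝓝 (X t ω - gbm μ σ W t ω)) := by
  obtain ⟨I, hI, heqn⟩ := hX.eqn
  have hcont : ∀ᵐ ω ∂P, Continuous fun s ↦ σ * X s ω := by
    filter_upwards [hX.cont] with ω hω using hω.const_mul σ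
  have hadapted : Adapted 𝓕 fun s ω ↦ σ * X s ω := fun s ↦ (hX.adapted s).const_mul σ
  obtain ⟨ns, hns, hito⟩ :=
    ((hI t).2 _ (approximatesOn_gridProcess hadapted hcont t)).exists_seq_tendsto_ae
  obtain ⟨ms, hms, hgbm⟩ :=
    ((tendstoInMeasure_eulerSum_gbm hW μ σ t).comp hns.tendsto_atTop).exists_seq_tendsto_ae
  refine ⟨ns ∘ ms, ?_⟩
  filter_upwards [hito, hgbm, heqn t, hX.cont] with ω hito hgbm heqn hcont
  have hriemann := (tendsto_grid_riemann_sum (hcont.const_mul μ) t).comp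
    (hns.tendsto_atTop.comp hms.tendsto_atTop)
  have heuler := (hriemann.add (hito.comp hms.tendsto_atTop)).sub hgbm
  have hlim : X t ω - gbm μ σ W t ω =
      (∫ s in (0 : ℝ)..t, μ * X s.toNNReal ω) + I t ω - (gbm μ σ W t ω - 1) := by
    rw [heqn]
    ring
  rw [hlim]
  refine heuler.congr fun k ↦ ?_
  rw [eulerSum_sub, eulerSum_eq_add]
  simp only [Function.comp_apply, gridProcess_integral, gridIncrement]

lemma integral_sq_le_of_ae_tendsto {f : ℕ → Ω → ℝ} {g : Ω → ℝ} {c : ℝ}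
    (hf : ∀ n, Measurable (f n)) (hg : Measurable g)
    (hlim : ∀ᵐ ω ∂P, g ω ≠ 0 → Tendsto (f · ω) atTop (𝓝 (g ω)))
    (hInt : ∀ n, Integrable (fun ω ↦ f n ω ^ 2) P) (hle : ∀ n, ∫ ω, f n ω ^ 2 ∂P ≤ c) :
    ∫ ω, g ω ^ 2 ∂P ≤ c := by
  have hc : 0 ≤ c := (integral_nonneg fun ω ↦ sq_nonneg (f 0 ω)).trans (hle 0)
  rw [integral_eq_lintegral_of_nonneg_ae (.of_forall fun ω ↦ sq_nonneg _)
    (hg.pow_const 2).aestronglyMeasurable]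
  refine ENNReal.toReal_le_of_le_ofReal hc ?_
  calc ∫⁻ ω, ENNReal.ofReal (g ω ^ 2) ∂P
      ≤ ∫⁻ ω, liminf (fun n ↦ ENNReal.ofReal (f n ω ^ 2)) atTop ∂P := by
        refine lintegral_mono_ae ?_
        filter_upwards [hlim] with ω hω
        by_cases hgω : g ω = 0
        · simp [hgω]
        · exact ((ENNReal.continuous_ofReal.tendsto _).comp ((hω hgω).pow 2)).liminf_eq.ge
    _ ≤ liminf (fun n ↦ ∫⁻ ω, ENNReal.ofReal (f n ω ^ 2) ∂P) atTop :=
        lintegral_liminf_le fun n ↦ ((hf n).pow_const 2).ennreal_ofReal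
    _ ≤ ENNReal.ofReal c := by
        refine liminf_le_of_frequently_le' (.of_forall fun n ↦ ?_)
        rw [← ofReal_integral_eq_lintegral_ofReal (hInt n) (.of_forall fun ω ↦ sq_nonneg _)]
        exact ENNReal.ofReal_le_ofReal (hle n)

lemma mesh_mul_sum_exp_le {L : ℝ} (hL : 0 < L) (t : ℝ≥0) (n : ℕ) :
    mesh t n * ∑ i ∈ Finset.range (n + 1), Real.exp (L * gridTime t n i) ≤
      Real.exp (L * t) / L := by
  rw [le_div_iff₀' hL, ← mul_assoc, Finset.mul_sum]
  calc ∑ i ∈ Finset.range (n + 1), L * mesh t n * Real.exp (L * gridTime t n i)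
      ≤ ∑ i ∈ Finset.range (n + 1),
        (Real.exp (L * gridTime t n (i + 1)) - Real.exp (L * gridTime t n i)) := by
        refine Finset.sum_le_sum fun i _ ↦ ?_
        rw [gridTime_succ, NNReal.coe_add, mul_add, Real.exp_add, ← mul_sub_one, mul_comm]
        gcongr
        exact le_sub_iff_add_le.2 (Real.add_one_le_exp _)
    _ = Real.exp (L * t) - 1 := by
        simp [Finset.sum_range_sub fun i ↦ Real.exp (L * gridTime t n i)]
    _ ≤ Real.exp (L * t) := sub_le_self _ zero_le_one

lemma mesh_mul_sum_le_of_le_exp {g : ℝ≥0 → ℝ} {s : ℝ≥0} {L M : ℝ} (hL : 0 < L) (hM : 0 ≤ M)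
    (hg : ∀ r ≤ s, g r ≤ M * Real.exp (L * r)) (n : ℕ) :
    mesh s n * ∑ i ∈ Finset.range (n + 1), g (gridTime s n i) ≤ M * (Real.exp (L * s) / L) :=
  calc mesh s n * ∑ i ∈ Finset.range (n + 1), g (gridTime s n i)
      ≤ mesh s n * ∑ i ∈ Finset.range (n + 1), M * Real.exp (L * gridTime s n i) := by
        gcongr with i hi
        exact hg _ (gridTime_le (Finset.mem_range.1 hi).le)
    _ = M * (mesh s n * ∑ i ∈ Finset.range (n + 1), Real.exp (L * gridTime s n i)) := by
        rw [← Finset.mul_sum, mul_left_comm]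
    _ ≤ M * (Real.exp (L * s) / L) := by
        gcongr
        exact mesh_mul_sum_exp_le hL s n

lemma nonpos_of_le_mesh_mul_sum {g : ℝ≥0 → ℝ} {T : ℝ≥0} {κ c₀ : ℝ} (hκ : 0 ≤ κ)
    (hbound : ∀ s ≤ T, g s ≤ c₀)
    (hstep : ∀ s ≤ T, ∀ c,
      (∀ n, κ * (mesh s n * ∑ i ∈ Finset.range (n + 1), g (gridTime s n i)) ≤ c) → g s ≤ c) :
    g T ≤ 0 := by
  -- In the norm weighted by `exp (-L s)` the Picard step is a contraction by the factor `1 / 2`.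
  set L : ℝ := 2 * κ + 1
  have hL : 0 < L := by positivity
  have hκL : κ / L ≤ 1 / 2 := by
    rw [div_le_div_iff₀ hL two_pos]
    linarith
  have hhalf (M : ℝ) (hM0 : 0 ≤ M) (hM : ∀ s ≤ T, g s ≤ M * Real.exp (L * s)) :
      ∀ s ≤ T, g s ≤ M / 2 * Real.exp (L * s) := by
    refine fun s hs ↦ hstep s hs _ fun n ↦ ?_
    calc κ * (mesh s n * ∑ i ∈ Finset.range (n + 1), g (gridTime s n i))
        ≤ κ * (M * (Real.exp (L * s) / L)) :=
          mul_le_mul_of_nonneg_left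
            (mesh_mul_sum_le_of_le_exp hL hM0 (fun r hr ↦ hM r (hr.trans hs)) n) hκ
      _ = κ / L * (M * Real.exp (L * s)) := by ring
      _ ≤ 1 / 2 * (M * Real.exp (L * s)) := by gcongr
      _ = M / 2 * Real.exp (L * s) := by ring
  have hiter (m : ℕ) : ∀ s ≤ T, g s ≤ |c₀| * (1 / 2) ^ m * Real.exp (L * s) := by
    induction m with
    | zero =>
      intro s hs
      rw [pow_zero, mul_one]
      exact ((hbound s hs).trans (le_abs_self c₀)).trans
        (le_mul_of_one_le_right (abs_nonneg _) (Real.one_le_exp (by positivity)))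
    | succ m ih =>
      rw [pow_succ, ← mul_assoc, mul_one_div]
      exact hhalf _ (by positivity) ih
  have hpow : Tendsto (fun m : ℕ ↦ (1 / 2 : ℝ) ^ m) atTop (𝓝 0) :=
    tendsto_pow_atTop_nhds_zero_of_lt_one (by norm_num) (by norm_num)
  have hlim := (hpow.const_mul |c₀|).mul_const (Real.exp (L * T))
  rw [mul_zero, zero_mul] at hlim
  exact ge_of_tendsto' hlim fun m ↦ hiter m T le_rfl

/-- The event that a process stays in `[-N, N]` up to time `s`, tested on a countable set of times
so that it is measurable whether or not the paths are continuous. -/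
def stayEvent (D : ℝ≥0 → Ω → ℝ) (N : ℝ) (s : ℝ≥0) : Set Ω :=
  {ω | ∀ n, |D (denseTime s n) ω| ≤ N}

lemma measurableSet_stayEvent (hD : Adapted 𝓕 D) (N : ℝ) (s : ℝ≥0) :
    MeasurableSet[𝓕 s] (stayEvent D N s) := by
  rw [stayEvent, Set.ofPred_forall]
  refine .iInter fun n ↦ ?_
  have hDn := (hD (denseTime s n)).mono (𝓕.mono (denseTime_le s n)) le_rfl
  exact hDn (measurableSet_le measurable_id.abs measurable_const : MeasurableSet {x : ℝ | |x| ≤ N})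

lemma abs_le_of_mem_stayEvent {N : ℝ} {s : ℝ≥0} {ω : Ω} (h : ω ∈ stayEvent D N s) :
    |D s ω| ≤ N := by
  obtain ⟨n, hn⟩ := exists_denseTime_eq s
  exact hn ▸ h n

lemma mem_stayEvent_iff {N : ℝ} {s : ℝ≥0} {ω : Ω} (hc : Continuous (D · ω)) :
    ω ∈ stayEvent D N s ↔ ∀ u ≤ s, |D u ω| ≤ N :=
  ⟨fun h _ hu ↦ le_of_forall_denseTime_le hc.abs h hu, fun h n ↦ h _ (denseTime_le s n)⟩

/-- A process set to `0` as soon as it has left `[-N, N]`. -/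
noncomputable def truncate (D : ℝ≥0 → Ω → ℝ) (N : ℝ) (s : ℝ≥0) : Ω → ℝ :=
  (stayEvent D N s).indicator (D s)

lemma adapted_truncate (hD : Adapted 𝓕 D) (N : ℝ) : Adapted 𝓕 (truncate D N) :=
  fun s ↦ (hD s).indicator (measurableSet_stayEvent hD N s)

lemma abs_truncate_le {N : ℝ} (hN : 0 ≤ N) (s : ℝ≥0) (ω : Ω) : |truncate D N s ω| ≤ N := by
  by_cases h : ω ∈ stayEvent D N s
  · rw [truncate, Set.indicator_of_mem h]
    exact abs_le_of_mem_stayEvent h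
  · rwa [truncate, Set.indicator_of_notMem h, abs_zero]

lemma memLp_two_truncate [IsFiniteMeasure P] (hD : Adapted 𝓕 D) {N : ℝ} (hN : 0 ≤ N) (s : ℝ≥0) :
    MemLp (truncate D N s) 2 P :=
  .of_bound ((adapted_truncate hD N s).mono (𝓕.le s) le_rfl).aestronglyMeasurable N
    (.of_forall (abs_truncate_le hN s))

lemma eulerSum_truncate_of_mem {N : ℝ} {s : ℝ≥0} {ω : Ω} (hc : Continuous (D · ω))
    (hω : ω ∈ stayEvent D N s) (n : ℕ) :
    eulerSum μ σ W (truncate D N) s n ω = eulerSum μ σ W D s n ω := by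
  rw [eulerSum, eulerSum, gridSum, gridSum]
  refine Finset.sum_congr rfl fun i hi ↦ ?_
  have hmem : ω ∈ stayEvent D N (gridTime s n i) := by
    rw [mem_stayEvent_iff hc] at hω ⊢
    exact fun u hu ↦ hω u (hu.trans (gridTime_le (Finset.mem_range.1 hi).le))
  rw [truncate, Set.indicator_of_mem hmem]

lemma truncate_ae_eq_zero_of_tendsto_eulerSum [IsProbabilityMeasure P]
    (hW : IsBrownianWrt 𝓕 W P) (hD : Adapted 𝓕 D) (hc : ∀ᵐ ω ∂P, Continuous (D · ω))
    (hlim : ∀ t, ∃ ns : ℕ → ℕ, ∀ᵐ ω ∂P,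
      Tendsto (fun k ↦ eulerSum μ σ W D t (ns k) ω) atTop (𝓝 (D t ω)))
    {N : ℝ} (hN : 0 ≤ N) (T : ℝ≥0) : truncate D N T =ᵐ[P] 0 := by
  have had := adapted_truncate hD N
  have hL2 := memLp_two_truncate (P := P) hD hN
  have hbound s (_ : s ≤ T) : ∫ ω, truncate D N s ω ^ 2 ∂P ≤ N ^ 2 := by
    refine (integral_mono (hL2 s).integrable_sq (integrable_const (N ^ 2)) fun ω ↦ ?_).trans_eq
      (by simp)
    exact sq_le_sq' (abs_le.1 (abs_truncate_le hN s ω)).1 (abs_le.1 (abs_truncate_le hN s ω)).2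
  have hzero : ∫ ω, truncate D N T ω ^ 2 ∂P ≤ 0 := by
    refine nonpos_of_le_mesh_mul_sum (g := fun s ↦ ∫ ω, truncate D N s ω ^ 2 ∂P)
      (κ := 2 * (2 * μ ^ 2 * T + σ ^ 2)) (by positivity) hbound fun s hs c hle ↦ ?_
    obtain ⟨ns, hns⟩ := hlim s
    refine integral_sq_le_of_ae_tendsto (f := fun k ↦ eulerSum μ σ W (truncate D N) s (ns k))
      (fun k ↦ hW.measurable_gridSum had s _ (by fun_prop)) ((had s).mono (𝓕.le s) le_rfl) ?_
      (fun k ↦ (hW.memLp_two_gridSum had hL2 s _ (by fun_prop)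
        (memLp_two_eulerStep μ σ _ _)).integrable_sq)
      (fun k ↦ (hW.integral_eulerSum_sq_le had hL2 μ σ hs _).trans (hle _))
    filter_upwards [hns, hc] with ω hns hc hne
    have hmem : ω ∈ stayEvent D N s := Set.mem_of_indicator_ne_zero hne
    rw [truncate, Set.indicator_of_mem hmem]
    exact hns.congr fun k ↦ (eulerSum_truncate_of_mem hc hmem _).symm
  have hsq := (integral_eq_zero_iff_of_nonneg (fun ω ↦ sq_nonneg (truncate D N T ω))
    (hL2 T).integrable_sq).1 (hzero.antisymm (integral_nonneg fun ω ↦ sq_nonneg _))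
  filter_upwards [hsq] with ω hω using pow_eq_zero_iff two_ne_zero |>.1 hω

lemma ae_eq_zero_of_tendsto_eulerSum [IsProbabilityMeasure P] (hW : IsBrownianWrt 𝓕 W P)
    (hD : Adapted 𝓕 D) (hc : ∀ᵐ ω ∂P, Continuous (D · ω))
    (hlim : ∀ t, ∃ ns : ℕ → ℕ, ∀ᵐ ω ∂P,
      Tendsto (fun k ↦ eulerSum μ σ W D t (ns k) ω) atTop (𝓝 (D t ω))) (T : ℝ≥0) :
    D T =ᵐ[P] 0 := by
  have hzero : ∀ᵐ ω ∂P, ∀ N : ℕ, truncate D N T ω = 0 := ae_all_iff.2 fun N ↦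
    truncate_ae_eq_zero_of_tendsto_eulerSum hW hD hc hlim N.cast_nonneg T
  filter_upwards [hzero, hc] with ω hzero hc
  obtain ⟨C, hC⟩ := (isCompact_Icc (a := (0 : ℝ≥0)) (b := T)).exists_bound_of_continuousOn
    hc.continuousOn
  obtain ⟨N, hN⟩ := exists_nat_ge C
  have hmem : ω ∈ stayEvent D N T :=
    (mem_stayEvent_iff hc).2 fun u hu ↦ (hC u ⟨zero_le, hu⟩).trans hN
  rw [Pi.zero_apply, ← hzero N, truncate, Set.indicator_of_mem hmem]

theorem IsGeometricBrownianMotion.ae_eq_gbm [IsProbabilityMeasure P]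
    (hX : IsGeometricBrownianMotion 𝓕 W P μ σ X) (hW : IsBrownianWrt 𝓕 W P) :
    ∀ᵐ ω ∂P, ∀ t, X t ω = gbm μ σ W t ω := by
  have hgbm : ∀ᵐ ω ∂P, Continuous (gbm μ σ W · ω) := by
    filter_upwards [hW.isBrownian.cont] with ω hω using continuous_gbm hω μ σ
  have hcont : ∀ᵐ ω ∂P, Continuous ((X - gbm μ σ W) · ω) := by
    filter_upwards [hX.cont, hgbm] with ω hX hgbm using hX.sub hgbm
  have heq : ∀ᵐ ω ∂P, ∀ n, (X - gbm μ σ W) (TopologicalSpace.denseSeq ℝ≥0 n) ω = 0 :=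
    ae_all_iff.2 fun n ↦ ae_eq_zero_of_tendsto_eulerSum hW
      (fun s ↦ (hX.adapted s).sub (adapted_gbm hW.adapted μ σ s)) hcont
      (hX.exists_seq_tendsto_eulerSum hW) _
  filter_upwards [heq, hX.cont, hgbm] with ω heq hX hgbm
  exact congrFun <| (TopologicalSpace.denseRange_denseSeq ℝ≥0).equalizer hX hgbm <|
    funext fun n ↦ sub_eq_zero.1 (heq n)

end Uniqueness

/-! ### Doob's maximal inequality -/

section Maximal

variable {Ω ι : Type*} {mΩ : MeasurableSpace Ω} {P : Measure Ω} [LinearOrder ι]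
  {𝓖 : Filtration ι mΩ} {M : ι → Ω → ℝ≥0∞}

lemma measurableSet_exists_mem_ge (hM : Adapted 𝓖 M) (r : ℝ≥0∞) {F : Finset ι} {t : ι}
    (ht : ∀ s ∈ F, s ≤ t) : MeasurableSet[𝓖 t] {ω | ∃ s ∈ F, r ≤ M s ω} := by
  have : {ω | ∃ s ∈ F, r ≤ M s ω} = ⋃ s ∈ F, {ω | r ≤ M s ω} := by
    ext
    simp only [Set.mem_ofPred_eq, Set.mem_iUnion, exists_prop]
  rw [this]
  exact F.measurableSet_biUnion fun s hs ↦
    𝓖.mono (ht s hs) _ (measurableSet_le measurable_const (hM s))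

lemma mul_measure_exists_mem_ge_le (hM : Adapted 𝓖 M)
    (hsub : ∀ s t, s ≤ t → ∀ A, MeasurableSet[𝓖 s] A → ∫⁻ ω in A, M s ω ∂P ≤ ∫⁻ ω in A, M t ω ∂P)
    (r : ℝ≥0∞) (F : Finset ι) {t : ι} (ht : ∀ s ∈ F, s ≤ t) :
    r * P {ω | ∃ s ∈ F, r ≤ M s ω} ≤ ∫⁻ ω in {ω | ∃ s ∈ F, r ≤ M s ω}, M t ω ∂P := by
  induction F using Finset.induction_on_max with
  | empty => simp
  | insert m F hm ih =>
    set A := {ω | ∃ s ∈ F, r ≤ M s ω}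
    set N := {ω | r ≤ M m ω} \ A
    have hunion : {ω | ∃ s ∈ insert m F, r ≤ M s ω} = A ∪ N := by
      rw [Set.union_sdiff_self, Set.union_comm]
      ext ω
      simp only [Finset.mem_insert, exists_eq_or_imp, Set.mem_ofPred_eq, Set.mem_union, A]
    have hNm : MeasurableSet[𝓖 m] N := (measurableSet_le measurable_const (hM m)).diff
      (measurableSet_exists_mem_ge hM r fun s hs ↦ (hm s hs).le)
    have hN : MeasurableSet N := 𝓖.le m _ hNm
    have hfirst : r * P N ≤ ∫⁻ ω in N, M t ω ∂P := by
      rw [← setLIntegral_const]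
      exact (setLIntegral_mono' hN fun ω hω ↦ hω.1).trans
        (hsub m t (ht m (Finset.mem_insert_self _ _)) N hNm)
    rw [hunion, measure_union Set.disjoint_sdiff_right hN,
      lintegral_union hN Set.disjoint_sdiff_right, mul_add]
    exact add_le_add (ih fun s hs ↦ ht s (Finset.mem_insert_of_mem hs)) hfirst

lemma mul_measure_exists_ge_le (hM : Adapted 𝓖 M)
    (hsub : ∀ s t, s ≤ t → ∀ A, MeasurableSet[𝓖 s] A → ∫⁻ ω in A, M s ω ∂P ≤ ∫⁻ ω in A, M t ω ∂P)
    {K : ℝ≥0∞} (hK : ∀ t, ∫⁻ ω, M t ω ∂P ≤ K) (r : ℝ≥0∞) (q : ℕ → ι) :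
    r * P {ω | ∃ n, r ≤ M (q n) ω} ≤ K := by
  have hU : {ω | ∃ n, r ≤ M (q n) ω} =
      ⋃ k : ℕ, {ω | ∃ s ∈ (Finset.range (k + 1)).image q, r ≤ M s ω} := by
    ext ω
    simp only [Set.mem_ofPred_eq, Set.mem_iUnion, Finset.mem_image, Finset.mem_range,
      exists_exists_and_eq_and]
    exact ⟨fun ⟨n, hn⟩ ↦ ⟨n, n, n.lt_succ_self, hn⟩, fun ⟨_, n, _, hn⟩ ↦ ⟨n, hn⟩⟩
  have hmono : Monotone fun k : ℕ ↦
      {ω | ∃ s ∈ (Finset.range (k + 1)).image q, r ≤ M s ω} := by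
    rintro k l hkl ω ⟨s, hs, h⟩
    exact ⟨s, Finset.image_subset_image (Finset.range_subset_range.2 (by lia)) hs, h⟩
  rw [hU, hmono.measure_iUnion, ENNReal.mul_iSup]
  refine iSup_le fun k ↦ ?_
  have hne : ((Finset.range (k + 1)).image q).Nonempty := by simp
  exact (mul_measure_exists_mem_ge_le hM hsub r _ fun s hs ↦ Finset.le_max' _ s hs).trans <|
    (setLIntegral_le_lintegral _ _).trans (hK (Finset.max' _ hne))

end Maximal

/-! ### Crossing of a line by Brownian motion -/

section LineCrossing

variable {Ω : Type*} {mΩ : MeasurableSpace Ω} {P : Measure Ω} {W : ℝ≥0 → Ω → ℝ}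

/-- The exponential martingale `exp (θ W_t - θ² t / 2)`, with values in `ℝ≥0∞` so that its integrals
need no integrability side conditions. -/
noncomputable def expMartingale (θ : ℝ) (W : ℝ≥0 → Ω → ℝ) (t : ℝ≥0) (ω : Ω) : ℝ≥0∞ :=
  ENNReal.ofReal (Real.exp (θ * W t ω - θ ^ 2 / 2 * t))

lemma lintegral_exp_gaussianReal (θ : ℝ) (d : ℝ≥0) :
    ∫⁻ w, ENNReal.ofReal (Real.exp (θ * w - θ ^ 2 / 2 * d)) ∂(gaussianReal 0 d) = 1 := by
  simp_rw [Real.exp_sub]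
  rw [← ofReal_integral_eq_lintegral_ofReal ((integrable_exp_mul_gaussianReal θ).div_const _)
    (Eventually.of_forall fun w ↦ by positivity), integral_div,
    integral_exp_mul_gaussianReal_zero, mul_comm (d : ℝ), div_mul_eq_mul_div,
    div_self (Real.exp_pos _).ne', ENNReal.ofReal_one]

lemma lintegral_expMartingale (hW : IsPreBrownianReal W P) (θ : ℝ) (t : ℝ≥0) :
    ∫⁻ ω, expMartingale θ W t ω ∂P = 1 :=
  ((hW.hasLaw_eval t).lintegral_comp (f := fun w ↦ ENNReal.ofReal
    (Real.exp (θ * w - θ ^ 2 / 2 * t))) (by fun_prop)).trans (lintegral_exp_gaussianReal θ t)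

lemma adapted_expMartingale (hWm : ∀ t, Measurable (W t)) (θ : ℝ) :
    Adapted (Filtration.natural W fun t ↦ (hWm t).stronglyMeasurable) (expMartingale θ W) :=
  fun t ↦ ((((Filtration.stronglyAdapted_natural fun t ↦ (hWm t).stronglyMeasurable)
    t).measurable.const_mul θ).sub_const _).exp.ennreal_ofReal

lemma expMartingale_add (θ : ℝ) (W : ℝ≥0 → Ω → ℝ) (s u : ℝ≥0) (ω : Ω) :
    expMartingale θ W (s + u) ω =
      expMartingale θ W s ω * expMartingale θ (fun u ω ↦ W (s + u) ω - W s ω) u ω := by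
  unfold expMartingale
  rw [← ENNReal.ofReal_mul (Real.exp_pos _).le, ← Real.exp_add]
  push_cast
  ring_nf

lemma setLIntegral_expMartingale_eq (hW : IsPreBrownianReal W P) (hWm : ∀ t, Measurable (W t))
    (θ : ℝ) {s t : ℝ≥0} (hst : s ≤ t) {A : Set Ω}
    (hA : MeasurableSet[Filtration.natural W (fun t ↦ (hWm t).stronglyMeasurable) s] A) :
    ∫⁻ ω in A, expMartingale θ W t ω ∂P = ∫⁻ ω in A, expMartingale θ W s ω ∂P := by
  obtain ⟨u, rfl⟩ := exists_add_of_le hst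
  set 𝓖 := Filtration.natural W fun t ↦ (hWm t).stronglyMeasurable
  set V : ℝ≥0 → Ω → ℝ := fun u ω ↦ W (s + u) ω - W s ω
  have hVm : Measurable fun ω u ↦ V u ω :=
    measurable_pi_lambda _ fun u ↦ (hWm _).sub (hWm _)
  have hindep : Indep (𝓖 s) (MeasurableSpace.comap (fun ω u ↦ V u ω) inferInstance) P := by
    rw [Filtration.natural_eq_comap]
    exact ((IndepFun_iff_Indep _ _ _).1 (hW.indepFun_shift s)).symm
  have hVu : Measurable[MeasurableSpace.comap (fun ω u ↦ V u ω) inferInstance] (V u) :=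
    (measurable_pi_apply (X := fun _ : ℝ≥0 ↦ ℝ) u).comp (comap_measurable fun ω u ↦ V u ω)
  have hmul := lintegral_mul_eq_lintegral_mul_lintegral_of_independent_measurableSpace
    (f := A.indicator (expMartingale θ W s)) (g := expMartingale θ V u) (𝓖.le s) hVm.comap_le
    hindep ((adapted_expMartingale hWm θ s).indicator hA)
    ((hVu.const_mul θ).sub_const _).exp.ennreal_ofReal
  rw [lintegral_expMartingale (hW.shift s), mul_one] at hmul
  rw [← lintegral_indicator (𝓖.le s _ hA), ← lintegral_indicator (𝓖.le s _ hA), ← hmul]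
  refine lintegral_congr fun ω ↦ ?_
  by_cases hω : ω ∈ A
  · rw [Set.indicator_of_mem hω, Set.indicator_of_mem hω, expMartingale_add]
  · rw [Set.indicator_of_notMem hω, Set.indicator_of_notMem hω, zero_mul]

lemma measure_cross_line_le (hW : IsPreBrownianReal W P) (hWm : ∀ t, Measurable (W t)) {a : ℝ}
    (c : ℝ) (ha : 0 ≤ a) (q : ℕ → ℝ≥0) :
    P {ω | ∃ n, c + a * q n ≤ W (q n) ω} ≤ ENNReal.ofReal (Real.exp (-(2 * a * c))) := by
  have hdoob := mul_measure_exists_ge_le (adapted_expMartingale hWm (2 * a))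
    (fun _ _ hst _ hA ↦ (setLIntegral_expMartingale_eq hW hWm (2 * a) hst hA).ge)
    (fun t ↦ (lintegral_expMartingale hW (2 * a) t).le)
    (ENNReal.ofReal (Real.exp (2 * a * c))) q
  rw [mul_comm, ← ENNReal.le_inv_iff_mul_le, ← ENNReal.ofReal_inv_of_pos (Real.exp_pos _),
    ← Real.exp_neg] at hdoob
  refine (measure_mono ?_).trans hdoob
  rintro ω ⟨n, hn⟩
  refine ⟨n, ENNReal.ofReal_le_ofReal (Real.exp_le_exp.2 ?_)⟩
  nlinarith only [mul_le_mul_of_nonneg_left hn ha]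

lemma measure_exists_abs_ge_le (hW : IsPreBrownianReal W P) (hWm : ∀ t, Measurable (W t)) {T : ℝ≥0}
    (hT : 0 < T) {x : ℝ} (hx : 0 ≤ x) {q : ℕ → ℝ≥0} (hq : ∀ n, q n ≤ T) :
    P {ω | ∃ n, x ≤ |W (q n) ω|} ≤ 2 * ENNReal.ofReal (Real.exp (-(x ^ 2 / (2 * T)))) := by
  have _ : (0 : ℝ) < T := hT
  have ha : 0 ≤ x / (2 * T) := by positivity
  have hline n : x / 2 + x / (2 * T) * q n ≤ x := by
    have hqn : (q n : ℝ) ≤ T := hq n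
    calc x / 2 + x / (2 * T) * q n ≤ x / 2 + x / (2 * T) * T := by gcongr
      _ = x := by field_simp; ring
  have hexponent : 2 * (x / (2 * T)) * (x / 2) = x ^ 2 / (2 * T) := by ring
  have hpos := measure_cross_line_le hW hWm (x / 2) ha q
  have hneg := measure_cross_line_le hW.neg (fun t ↦ (hWm t).neg) (x / 2) ha q
  rw [hexponent] at hpos hneg
  rw [two_mul]
  refine ((measure_mono ?_).trans (measure_union_le _ _)).trans (add_le_add hpos hneg)
  rintro ω ⟨n, hn⟩
  rcases le_abs.1 hn with h | h
  · exact Or.inl ⟨n, (hline n).trans h⟩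
  · exact Or.inr ⟨n, (hline n).trans h⟩

end LineCrossing

/-! ### The Brownian bridge -/

section Bridge

variable {Ω : Type*} {mΩ : MeasurableSpace Ω} {P : Measure Ω} {W : ℝ≥0 → Ω → ℝ} {T : ℝ≥0}
  {q : ℕ → ℝ≥0}

/-- The bridge `W_t - (t / T) W_T` from `0` to `0` on `[0, T]`. -/
noncomputable def bridge (W : ℝ≥0 → Ω → ℝ) (T t : ℝ≥0) (ω : Ω) : ℝ :=
  W t ω - t / T * W T ω

lemma measurable_bridge (hWm : ∀ t, Measurable (W t)) (T t : ℝ≥0) : Measurable (bridge W T t) :=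
  (hWm t).sub ((hWm T).const_mul _)

lemma bridge_self (W : ℝ≥0 → Ω → ℝ) (hT : 0 < T) (ω : Ω) : bridge W T T ω = 0 := by
  rw [bridge, div_self (NNReal.coe_ne_zero.2 hT.ne'), one_mul, sub_self]

lemma covariance_bridge_terminal (hW : IsPreBrownianReal W P) (hT : 0 < T) {t : ℝ≥0} (ht : t ≤ T) :
    cov[bridge W T t, W T; P] = 0 := by
  have := hW.isGaussianProcess.isProbabilityMeasure
  have hT' : (T : ℝ) ≠ 0 := NNReal.coe_ne_zero.2 hT.ne'
  have hL2 (s : ℝ≥0) : MemLp (W s) 2 P := (hW.isGaussianProcess.hasGaussianLaw_eval s).memLp_two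
  unfold bridge
  rw [covariance_fun_sub_left (hL2 _) ((hL2 _).const_mul _) (hL2 _), covariance_const_mul_left,
    hW.covariance_fun_eval, hW.covariance_fun_eval, min_eq_left ht, min_self,
    div_mul_cancel₀ _ hT', sub_self]

lemma indepFun_bridge (hW : IsPreBrownianReal W P) (hT : 0 < T) (hq : ∀ n, q n ≤ T) :
    IndepFun (fun ω n ↦ bridge W T (q n) ω) (W T) P := by
  have h : IndepFun (fun ω n ↦ bridge W T (q n) ω) (fun ω (_ : Unit) ↦ W T ω) P := by
    refine IsGaussianProcess.indepFun_of_covariance_eq_zero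
      (X := fun n ω ↦ bridge W T (q n) ω) (Y := fun (_ : Unit) ω ↦ W T ω) ?_
      (fun n ↦ (hW.aemeasurable _).sub ((hW.aemeasurable _).const_mul _))
      (fun _ ↦ hW.aemeasurable _) (fun n _ ↦ covariance_bridge_terminal hW hT (hq n))
    refine hW.isGaussianProcess.of_isGaussianProcess ?_
    rintro (n | u)
    · exact ⟨{q n, T},
        { toFun x := x ⟨q n, by simp⟩ - q n / T * x ⟨T, by simp⟩
          map_add' x y := by simp; ring
          map_smul' c x := by simp; ring }, by simp [bridge]⟩
    · exact ⟨{T},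
        { toFun x := x ⟨T, by simp⟩
          map_add' x y := by simp
          map_smul' c x := by simp }, by simp⟩
  exact h.comp measurable_id (measurable_pi_apply ())

-- For `s ≠ 0` this process is the time inversion of a shift of the time inversion of `W`.
lemma isPreBrownianReal_scaled_bridge (hW : IsPreBrownianReal W P) (hT : 0 < T) :
    IsPreBrownianReal (fun s ω ↦ ((s : ℝ) + T) / T * bridge W T (s * T / (s + T)) ω) P := by
  refine (hW.inv.shift (1 / T)).inv.congr fun s ↦ ?_
  rcases eq_or_ne s 0 with rfl | hs
  · filter_upwards [hW.eval_zero_ae_eq_zero] with ω hω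
    simp [bridge, hω]
  · refine Eventually.of_forall fun ω ↦ ?_
    have htime : 1 / (1 / T + 1 / s) = s * T / (s + T) := by
      field_simp
    have hs' : (s : ℝ) ≠ 0 := NNReal.coe_ne_zero.2 hs
    have hT' : (T : ℝ) ≠ 0 := NNReal.coe_ne_zero.2 hT.ne'
    have hsT : (s : ℝ) + T ≠ 0 := by positivity
    simp only [htime, one_div_one_div, bridge]
    push_cast
    field_simp

lemma measure_bridge_cross_le (hW : IsPreBrownianReal W P) (hWm : ∀ t, Measurable (W t))
    (hT : 0 < T) (hq : ∀ n, q n ≤ T) (c : ℝ) {y : ℝ} (hy : 0 < y) :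
    P {ω | ∃ n, c * (1 - q n / T) + y * (q n / T) ≤ bridge W T (q n) ω} ≤
      ENNReal.ofReal (Real.exp (-(2 * c * y / T))) := by
  have hT' : (0 : ℝ) < T := hT
  have hcross := measure_cross_line_le (isPreBrownianReal_scaled_bridge hW hT)
    (fun t ↦ (measurable_bridge hWm _ _).const_mul _) c (a := y / T) (by positivity)
    (fun n ↦ q n * T / (T - q n))
  rw [show 2 * (y / T) * c = 2 * c * y / T by ring] at hcross
  refine (measure_mono ?_).trans hcross
  rintro ω ⟨n, hn⟩
  refine ⟨n, ?_⟩
  rcases (hq n).eq_or_lt with hqT | hqT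
  · rw [hqT, bridge_self W hT, div_self hT'.ne'] at hn
    linarith
  · have hpos : (0 : ℝ) < T - q n := sub_pos.2 hqT
    set s : ℝ≥0 := q n * T / (T - q n) with hs
    have hsc : (s : ℝ) = q n * T / (T - q n) := by
      rw [hs]; push_cast [NNReal.coe_sub hqT.le]; rfl
    have htime : s * T / (s + T) = q n := by
      ext
      push_cast
      rw [hsc]
      field_simp
      ring
    have hspace : ((s : ℝ) + T) / T = T / (T - q n) := by
      rw [hsc]; field_simp; ring
    rw [htime, hspace]
    calc c + y / T * s = T / (T - q n) * (c * (1 - q n / T) + y * (q n / T)) := by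
          rw [hsc]; field_simp
      _ ≤ _ := by gcongr

lemma abs_bridge_le (W : ℝ≥0 → Ω → ℝ) {t : ℝ≥0} (ht : t ≤ T) (ω : Ω) :
    |bridge W T t ω| ≤ |W t ω| + |W T ω| := by
  have hfrac : (t : ℝ) / T ≤ 1 := div_le_one_of_le₀ ht T.2
  refine (abs_sub _ _).trans ?_
  rw [abs_mul, abs_of_nonneg (by positivity : (0 : ℝ) ≤ t / T)]
  gcongr
  exact mul_le_of_le_one_left (abs_nonneg _) hfrac

lemma measure_exists_abs_bridge_ge_le (hW : IsPreBrownianReal W P) (hWm : ∀ t, Measurable (W t))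
    (hT : 0 < T) {x : ℝ} (hx : 0 ≤ x) (hq : ∀ n, q n ≤ T) :
    P {ω | ∃ n, x ≤ |bridge W T (q n) ω|} ≤
      4 * ENNReal.ofReal (Real.exp (-(x ^ 2 / (8 * T)))) := by
  have hpath := measure_exists_abs_ge_le hW hWm hT (x := x / 2) (by positivity) hq
  have hend := measure_exists_abs_ge_le hW hWm hT (x := x / 2) (by positivity) (q := fun _ ↦ T)
    fun _ ↦ le_rfl
  rw [show (x / 2) ^ 2 / (2 * T) = x ^ 2 / (8 * T) by ring] at hpath hend
  rw [show (4 : ℝ≥0∞) = 2 + 2 by norm_num, add_mul]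
  refine ((measure_mono ?_).trans (measure_union_le _ _)).trans (add_le_add hpath hend)
  rintro ω ⟨n, hn⟩
  rcases le_or_gt (x / 2) |W (q n) ω| with h | h
  · exact Or.inl ⟨n, h⟩
  · exact Or.inr ⟨0, by linarith [abs_bridge_le W (hq n) ω]⟩

/-- The exponential of the normalized maximum of a path sampled at countably many times. -/
noncomputable def expSup (l : ℝ) (T : ℝ≥0) (w : ℕ → ℝ) : ℝ≥0∞ :=
  ⨆ n, ENNReal.ofReal (Real.exp (l * (|w n| / √T)))

lemma measurable_expSup (l : ℝ) (T : ℝ≥0) : Measurable (expSup l T) :=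
  Measurable.iSup fun n ↦ by fun_prop

lemma expSup_pow (l : ℝ) (T : ℝ≥0) (w : ℕ → ℝ) (k : ℕ) :
    expSup l T w ^ k = expSup (k * l) T w := by
  unfold expSup
  rw [ENNReal.iSup_pow]
  congr! 2 with n
  rw [← ENNReal.ofReal_pow (Real.exp_pos _).le, ← Real.exp_nat_mul, mul_assoc]

/-- A bound for the `l`-th exponential moment of the normalized maximum of a Brownian bridge,
obtained by summing its Gaussian tails. -/
noncomputable def expMomentConst (l : ℝ) : ℝ≥0∞ :=
  ∑' n : ℕ, 4 * ENNReal.ofReal (Real.exp (l * (n + 1) - n ^ 2 / 8))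

lemma expMomentConst_ne_top (l : ℝ) : expMomentConst l ≠ ∞ := by
  have hgeo : Summable fun n : ℕ ↦ Real.exp (l + 2 * (l + 1) ^ 2) * Real.exp (-(n : ℝ)) :=
    Real.summable_exp_neg_nat.mul_left _
  unfold expMomentConst
  rw [ENNReal.tsum_mul_left]
  refine ENNReal.mul_ne_top (by simp) (Summable.tsum_ofReal_ne_top ?_)
  refine hgeo.of_nonneg_of_le (fun n ↦ (Real.exp_pos _).le) fun n ↦ ?_
  rw [← Real.exp_add, Real.exp_le_exp]
  nlinarith only [sq_nonneg ((n : ℝ) - 4 * (l + 1))]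

lemma expSup_le_tsum_indicator {l : ℝ} (hl : 0 ≤ l) (hT : 0 < T) (w : ℕ → ℝ) :
    expSup l T w ≤ ∑' n : ℕ, {w : ℕ → ℝ | ∃ k, n * √T ≤ |w k|}.indicator
      (fun _ ↦ ENNReal.ofReal (Real.exp (l * (n + 1)))) w := by
  have hs : 0 < √(T : ℝ) := Real.sqrt_pos.2 hT
  refine iSup_le fun k ↦ ?_
  set x := |w k| / √T
  have hmem : w ∈ {w : ℕ → ℝ | ∃ k, ⌊x⌋₊ * √T ≤ |w k|} :=
    ⟨k, (le_div_iff₀ hs).1 (Nat.floor_le (by positivity))⟩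
  refine le_trans ?_ (ENNReal.le_tsum ⌊x⌋₊)
  rw [Set.indicator_of_mem hmem]
  gcongr
  exact (Nat.lt_floor_add_one x).le

lemma lintegral_expSup_bridge_le (hW : IsPreBrownianReal W P) (hWm : ∀ t, Measurable (W t))
    (hT : 0 < T) {l : ℝ} (hl : 0 ≤ l) (hq : ∀ n, q n ≤ T) :
    ∫⁻ ω, expSup l T (fun n ↦ bridge W T (q n) ω) ∂P ≤ expMomentConst l := by
  let S : ℕ → Set Ω := fun n ↦ {ω | ∃ k, n * √T ≤ |bridge W T (q k) ω|}
  have hS n : MeasurableSet (S n) := by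
    simp only [S, Set.ofPred_exists]
    exact MeasurableSet.iUnion fun k ↦
      measurableSet_le measurable_const (measurable_bridge hWm _ _).abs
  calc ∫⁻ ω, expSup l T (fun n ↦ bridge W T (q n) ω) ∂P
      ≤ ∫⁻ ω, ∑' n : ℕ, (S n).indicator
        (fun _ ↦ ENNReal.ofReal (Real.exp (l * (n + 1)))) ω ∂P :=
        lintegral_mono fun ω ↦ expSup_le_tsum_indicator hl hT _
    _ = ∑' n : ℕ, ENNReal.ofReal (Real.exp (l * (n + 1))) * P (S n) := by
        rw [lintegral_tsum fun n ↦ (measurable_const.indicator (hS n)).aemeasurable]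
        exact tsum_congr fun n ↦ lintegral_indicator_const (hS n) _
    _ ≤ expMomentConst l := by
        refine ENNReal.tsum_le_tsum fun n ↦ ?_
        refine (mul_le_mul_right (measure_exists_abs_bridge_ge_le hW hWm hT (by positivity) hq)
          _).trans_eq ?_
        have hexponent : ((n : ℝ) * √T) ^ 2 / (8 * T) = n ^ 2 / 8 := by
          rw [mul_pow, Real.sq_sqrt T.coe_nonneg]
          field_simp
        rw [hexponent, mul_left_comm, ← ENNReal.ofReal_mul (Real.exp_pos _).le, ← Real.exp_add]
        rfl

end Bridge

/-! ### Estimates conditional on the terminal value -/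

section Conditional

variable {Ω : Type*} {mΩ : MeasurableSpace Ω} {P : Measure Ω} {W : ℝ≥0 → Ω → ℝ} {T : ℝ≥0}
  {q : ℕ → ℝ≥0}

lemma setLIntegral_le_rpow_mul_measure_rpow {f : Ω → ℝ≥0∞} (hf : AEMeasurable f P) (A : Set Ω)
    {p p' : ℝ} (hp : p.HolderConjugate p') :
    ∫⁻ ω in A, f ω ∂P ≤ (∫⁻ ω, f ω ^ p ∂P) ^ (1 / p) * P A ^ (1 / p') := by
  have hholder := ENNReal.lintegral_mul_le_Lp_mul_Lq (P.restrict A) hp hf.restrict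
    (aemeasurable_const (b := (1 : ℝ≥0∞)))
  simp only [Pi.mul_apply, mul_one, ENNReal.one_rpow, setLIntegral_one] at hholder
  have := hp.pos
  exact hholder.trans (by gcongr; exact Measure.restrict_le_self)

lemma lintegral_comp_prodMk_of_indepFun [IsFiniteMeasure P] {α β : Type*} [MeasurableSpace α]
    [MeasurableSpace β] {f : Ω → α} {g : Ω → β} (hf : Measurable f) (hg : AEMeasurable g P)
    (hfg : IndepFun f g P) {G : α × β → ℝ≥0∞} (hG : Measurable G) :
    ∫⁻ ω, G (f ω, g ω) ∂P = ∫⁻ y, ∫⁻ ω, G (f ω, y) ∂P ∂(P.map g) := by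
  rw [← lintegral_map' hG.aemeasurable (hf.aemeasurable.prodMk hg),
    (indepFun_iff_map_prod_eq_prod_map_map hf.aemeasurable hg).1 hfg, lintegral_prod_symm' _ hG]
  exact lintegral_congr fun y ↦ lintegral_map (hG.comp measurable_prodMk_right) hf

/-- The paths `w` of a bridge, sampled at the times `q n`, for which `σ w` with the linear path
from `0` to `b + y` added comes arbitrarily close to the level `b`. Closeness replaces attainment
because the times `q n` may miss the maximum. -/
def reachSet (σ b : ℝ) (T : ℝ≥0) (q : ℕ → ℝ≥0) (y : ℝ) : Set (ℕ → ℝ) :=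
  {w | ∀ j : ℕ, ∃ n, b - 1 / (j + 1) ≤ σ * w n + q n / T * (b + y)}

lemma measurableSet_reachSet (σ b : ℝ) (T : ℝ≥0) (q : ℕ → ℝ≥0) :
    MeasurableSet {p : (ℕ → ℝ) × ℝ | p.1 ∈ reachSet σ b T q p.2} := by
  have hset : {p : (ℕ → ℝ) × ℝ | p.1 ∈ reachSet σ b T q p.2} = ⋂ j : ℕ, ⋃ n : ℕ,
      {p : (ℕ → ℝ) × ℝ | b - 1 / ((j : ℝ) + 1) ≤ σ * p.1 n + q n / T * (b + p.2)} := by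
    ext p
    simp [reachSet]
  rw [hset]
  refine MeasurableSet.iInter fun j ↦ MeasurableSet.iUnion fun n ↦
    measurableSet_le measurable_const ?_
  fun_prop

-- Being within `ε` of the level `b` is a line crossing; the bound is its limit as `ε → 0`.
lemma measure_bridge_mem_reachSet_le_of_neg (hW : IsPreBrownianReal W P)
    (hWm : ∀ t, Measurable (W t)) (hT : 0 < T) (hq : ∀ n, q n ≤ T) {σ : ℝ} (hσ : 0 < σ) (b : ℝ)
    {y : ℝ} (hy : y < 0) :
    P {ω | (fun n ↦ bridge W T (q n) ω) ∈ reachSet σ b T q y} ≤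
      ENNReal.ofReal (Real.exp (2 * b * y / (σ ^ 2 * T))) := by
  have _ : (0 : ℝ) < T := hT
  have hε := tendsto_one_div_add_atTop_nhds_zero_nat (𝕜 := ℝ)
  have hlim : Tendsto (fun j : ℕ ↦ ENNReal.ofReal (Real.exp
      (-(2 * ((b - 1 / ((j : ℝ) + 1)) / σ) * ((-y - 1 / ((j : ℝ) + 1)) / σ) / T)))) atTop
      (𝓝 (ENNReal.ofReal (Real.exp (2 * b * y / (σ ^ 2 * T))))) := by
    have hcont : Continuous fun ε : ℝ ↦ ENNReal.ofReal (Real.exp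
      (-(2 * ((b - ε) / σ) * ((-y - ε) / σ) / T))) :=
      ENNReal.continuous_ofReal.comp (by fun_prop)
    have hzero : -(2 * ((b - 0) / σ) * ((-y - 0) / σ) / T) = 2 * b * y / (σ ^ 2 * T) := by
      field_simp
      ring
    exact hzero ▸ (hcont.tendsto 0).comp hε
  refine ge_of_tendsto hlim ?_
  filter_upwards [hε.eventually_lt_const (show 0 < -y by linarith)] with j hj
  refine (measure_mono fun ω hω ↦ ?_).trans (measure_bridge_cross_le hW hWm hT hq
    ((b - 1 / ((j : ℝ) + 1)) / σ) (y := (-y - 1 / ((j : ℝ) + 1)) / σ)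
    (div_pos (by linarith) hσ))
  obtain ⟨n, hn⟩ := hω j
  refine ⟨n, ?_⟩
  calc (b - 1 / ((j : ℝ) + 1)) / σ * (1 - q n / T) + (-y - 1 / ((j : ℝ) + 1)) / σ * (q n / T)
      = (b - 1 / ((j : ℝ) + 1) - q n / T * (b + y)) / σ := by ring
    _ ≤ bridge W T (q n) ω := by rw [div_le_iff₀ hσ]; linarith

lemma measure_bridge_mem_reachSet_le [IsProbabilityMeasure P] (hW : IsPreBrownianReal W P)
    (hWm : ∀ t, Measurable (W t)) (hT : 0 < T) (hq : ∀ n, q n ≤ T) {σ : ℝ} (hσ : 0 < σ) (b y : ℝ) :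
    P {ω | (fun n ↦ bridge W T (q n) ω) ∈ reachSet σ b T q y} ≤
      ENNReal.ofReal (Real.exp (2 * b * min y 0 / (σ ^ 2 * T))) := by
  rcases lt_or_ge y 0 with hy | hy
  · rw [min_eq_left hy.le]
    exact measure_bridge_mem_reachSet_le_of_neg hW hWm hT hq hσ b hy
  · rw [min_eq_right hy, mul_zero, zero_div, Real.exp_zero, ENNReal.ofReal_one]
    exact prob_le_one

lemma setLIntegral_expSup_reachSet_le [IsProbabilityMeasure P] (hW : IsPreBrownianReal W P)
    (hWm : ∀ t, Measurable (W t)) (hT : 0 < T) (hq : ∀ n, q n ≤ T) {σ : ℝ} (hσ : 0 < σ) (b y : ℝ)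
    {l : ℝ} (hl : 0 ≤ l) :
    ∫⁻ ω in {ω | (fun n ↦ bridge W T (q n) ω) ∈ reachSet σ b T q y},
        expSup l T (fun n ↦ bridge W T (q n) ω) ∂P ≤
      expMomentConst (4 * l) ^ (1 / 4 : ℝ) *
        ENNReal.ofReal (Real.exp (3 / 2 * b * min y 0 / (σ ^ 2 * T))) := by
  have hmeas : Measurable fun ω ↦ expSup l T (fun n ↦ bridge W T (q n) ω) :=
    (measurable_expSup l T).comp (measurable_pi_lambda _ fun n ↦ measurable_bridge hWm T (q n))
  refine (setLIntegral_le_rpow_mul_measure_rpow hmeas.aemeasurable _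
    (show Real.HolderConjugate 4 (4 / 3) by constructor <;> norm_num)).trans (mul_le_mul' ?_ ?_)
  · have hpow (ω : Ω) : expSup l T (fun n ↦ bridge W T (q n) ω) ^ (4 : ℝ) =
        expSup (4 * l) T (fun n ↦ bridge W T (q n) ω) := by
      exact_mod_cast expSup_pow l T (fun n ↦ bridge W T (q n) ω) 4
    simp_rw [hpow]
    gcongr
    exact lintegral_expSup_bridge_le hW hWm hT (by positivity) hq
  · refine (ENNReal.rpow_le_rpow (measure_bridge_mem_reachSet_le hW hWm hT hq hσ b y)
      (by norm_num)).trans_eq ?_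
    rw [ENNReal.ofReal_rpow_of_pos (Real.exp_pos _), ← Real.exp_mul]
    congr 2
    ring

end Conditional

/-! ### Integration over the terminal value -/

section Terminal

lemma lintegral_exp_neg_mul_abs {a : ℝ} (ha : 0 < a) :
    ∫⁻ y : ℝ, ENNReal.ofReal (Real.exp (-a * |y|)) = ENNReal.ofReal (2 / a) := by
  have hval : ∫ y : ℝ, Real.exp (-a * |y|) = 2 / a := by
    rw [integral_comp_abs (f := fun y ↦ Real.exp (-a * y)),
      integral_exp_mul_Ioi (neg_lt_zero.2 ha), mul_zero, Real.exp_zero, neg_div_neg_eq,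
      mul_one_div]
  have hint : Integrable fun y : ℝ ↦ Real.exp (-a * |y|) :=
    .of_integral_ne_zero (by rw [hval]; positivity)
  rw [← ofReal_integral_eq_lintegral_ofReal hint (Eventually.of_forall fun _ ↦ (Real.exp_pos _).le),
    hval]

lemma gaussianPDFReal_neg_mean (m : ℝ) (v : ℝ≥0) (y : ℝ) :
    gaussianPDFReal (-m) v y =
      gaussianPDFReal (-m) v 0 * Real.exp (-(2 * m * y + y ^ 2) / (2 * v)) := by
  simp only [gaussianPDFReal]
  rw [mul_assoc _ (Real.exp _), ← Real.exp_add]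
  ring_nf

lemma gaussianPDFReal_neg_mean_le (m : ℝ) (v : ℝ≥0) (y : ℝ) :
    gaussianPDFReal (-m) v y ≤ gaussianPDFReal (-m) v 0 * Real.exp (-(m * y) / v) := by
  rw [gaussianPDFReal_neg_mean]
  refine mul_le_mul_of_nonneg_left (Real.exp_le_exp.2 ?_) (gaussianPDFReal_nonneg _ _ _)
  calc -(2 * m * y + y ^ 2) / (2 * v) ≤ 2 * (-(m * y)) / (2 * v) := by
        gcongr
        linarith [sq_nonneg y]
    _ = -(m * y) / v := mul_div_mul_left _ _ two_ne_zero

-- For `y < 0` the Gaussian density grows like `exp (m |y| / v)` with `m` close to `b`; the reaching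
-- probability, even weakened to `exp (-3 b |y| / (2 v))`, outweighs this growth.
lemma tilted_exponent_le {b m v y : ℝ} (hv : 0 < v) (hvb : 8 * v ≤ b) (hm1 : 7 / 8 * b ≤ m)
    (hm2 : m ≤ 9 / 8 * b) :
    |y| + -(m * y) / v + 3 / 2 * b * min y 0 / v ≤ -(b / (4 * v)) * |y| := by
  have hscaled : |y| * v + -(m * y) + 3 / 2 * b * min y 0 ≤ -(b / 4) * |y| := by
    rcases le_or_gt 0 y with hy | hy
    · rw [abs_of_nonneg hy, min_eq_right hy]
      nlinarith only [mul_le_mul_of_nonneg_left hm1 hy, mul_le_mul_of_nonneg_left hvb hy,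
        mul_nonneg hy hv.le]
    · rw [abs_of_neg hy, min_eq_left hy.le]
      nlinarith only [mul_le_mul_of_nonpos_left hm2 hy.le, mul_le_mul_of_nonpos_left hvb hy.le]
  calc |y| + -(m * y) / v + 3 / 2 * b * min y 0 / v
      = (|y| * v + -(m * y) + 3 / 2 * b * min y 0) / v := by field_simp
    _ ≤ -(b / 4) * |y| / v := by gcongr
    _ = -(b / (4 * v)) * |y| := by field_simp

lemma sqrt_add_abs_le_mul_exp {κ T : ℝ} (hκ : 0 < κ) (hT : 0 < T) (hT1 : T ≤ 1) (y : ℝ) :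
    √T + |y| ≤ √T * ((1 + 2 / (κ * T)) * Real.exp (κ / 2 * |y|)) := by
  have hTs : T ≤ √T := Real.le_sqrt_of_sq_le (by nlinarith only [hT, hT1])
  have habs : |y| ≤ √T * (|y| / T) := by
    rw [mul_div_assoc', le_div_iff₀ hT, mul_comm]
    gcongr
  have hlin : 1 + |y| / T ≤ (1 + 2 / (κ * T)) * Real.exp (κ / 2 * |y|) := by
    calc 1 + |y| / T ≤ 1 + |y| / T + (2 / (κ * T) + κ / 2 * |y|) :=
          le_add_of_nonneg_right (by positivity)
      _ = (1 + 2 / (κ * T)) * (κ / 2 * |y| + 1) := by field_simp; ring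
      _ ≤ _ := by gcongr; exact Real.add_one_le_exp _
  calc √T + |y| ≤ √T * (1 + |y| / T) := by rw [mul_add, mul_one]; gcongr
    _ ≤ _ := by gcongr

lemma gaussianPDFReal_mul_tilt_le {b m T : ℝ} {v : ℝ≥0} (hT : 0 < T) (hT1 : T ≤ 1) (hv : 0 < v)
    (hvb : 8 * v ≤ b) (hm1 : 7 / 8 * b ≤ m) (hm2 : m ≤ 9 / 8 * b) (y : ℝ) :
    gaussianPDFReal (-m) v y *
        ((√T + |y|) * Real.exp |y| * Real.exp (3 / 2 * b * min y 0 / v)) ≤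
      gaussianPDFReal (-m) v 0 * √T * (1 + 8 * v / (b * T)) *
        Real.exp (-(b / (8 * v)) * |y|) := by
  have hv' : (0 : ℝ) < v := hv
  have hb : 0 < b := by linarith
  set p := gaussianPDFReal (-m) v 0
  have hp : 0 ≤ p := gaussianPDFReal_nonneg _ _ _
  calc _ ≤ (p * Real.exp (-(m * y) / v)) *
        ((√T + |y|) * Real.exp |y| * Real.exp (3 / 2 * b * min y 0 / v)) := by
        gcongr
        exact gaussianPDFReal_neg_mean_le m v y
    _ = p * (√T + |y|) * Real.exp (|y| + -(m * y) / v + 3 / 2 * b * min y 0 / v) := by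
        rw [Real.exp_add, Real.exp_add]
        ring
    _ ≤ p * (√T * ((1 + 2 / (b / (4 * v) * T)) * Real.exp (b / (4 * v) / 2 * |y|))) *
        Real.exp (-(b / (4 * v)) * |y|) := by
        gcongr
        · exact sqrt_add_abs_le_mul_exp (by positivity) hT hT1 y
        · exact tilted_exponent_le hv' hvb hm1 hm2
    _ = p * √T * (1 + 2 / (b / (4 * v) * T)) *
        Real.exp (b / (4 * v) / 2 * |y| + -(b / (4 * v)) * |y|) := by
        rw [Real.exp_add]
        ring
    _ = _ := by
        congr 2
        · field_simp
          ring
        · field_simp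
          ring

lemma lintegral_gaussianReal_tilt_le {b m T : ℝ} {v : ℝ≥0} (hT : 0 < T) (hT1 : T ≤ 1) (hv : 0 < v)
    (hvb : 8 * v ≤ b) (hm1 : 7 / 8 * b ≤ m) (hm2 : m ≤ 9 / 8 * b) :
    ∫⁻ y, ENNReal.ofReal ((√T + |y|) * Real.exp |y| * Real.exp (3 / 2 * b * min y 0 / v))
        ∂(gaussianReal (-m) v) ≤
      ENNReal.ofReal (gaussianPDFReal (-m) v 0 * √T * (1 + 8 * v / (b * T)) * (16 * v / b)) := by
  have _ : (0 : ℝ) < v := hv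
  have hb : 0 < b := by linarith
  have hp : 0 ≤ gaussianPDFReal (-m) v 0 := gaussianPDFReal_nonneg _ _ _
  rw [gaussianReal_of_var_ne_zero _ hv.ne', lintegral_withDensity_eq_lintegral_mul _
    (measurable_gaussianPDF _ _) (by fun_prop)]
  calc _ ≤ ∫⁻ y : ℝ, ENNReal.ofReal (gaussianPDFReal (-m) v 0 * √T * (1 + 8 * v / (b * T))) *
        ENNReal.ofReal (Real.exp (-(b / (8 * v)) * |y|)) := by
        refine lintegral_mono fun y ↦ ?_
        simp only [Pi.mul_apply, gaussianPDF]
        rw [← ENNReal.ofReal_mul (gaussianPDFReal_nonneg _ _ _),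
          ← ENNReal.ofReal_mul (by positivity)]
        exact ENNReal.ofReal_le_ofReal (gaussianPDFReal_mul_tilt_le hT hT1 hv hvb hm1 hm2 y)
    _ = _ := by
        rw [lintegral_const_mul _ (by fun_prop), lintegral_exp_neg_mul_abs (by positivity),
          ← ENNReal.ofReal_mul (by positivity)]
        congr 2
        field_simp
        norm_num

lemma ofReal_mul_le_gaussianReal_Ici {m δ : ℝ} {v : ℝ≥0} (hm : 0 ≤ m) (hδ : 0 ≤ δ) (hv : v ≠ 0) :
    ENNReal.ofReal (Real.exp (-((2 * m + δ) * δ / (2 * v))) * (gaussianPDFReal (-m) v 0 * δ)) ≤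
      gaussianReal (-m) v (Set.Ici 0) := by
  have hp : 0 ≤ gaussianPDFReal (-m) v 0 := gaussianPDFReal_nonneg _ _ _
  rw [gaussianReal_apply _ hv]
  calc _ = ∫⁻ _ in Set.Icc (0 : ℝ) δ, ENNReal.ofReal
        (gaussianPDFReal (-m) v 0 * Real.exp (-((2 * m + δ) * δ / (2 * v)))) := by
        rw [setLIntegral_const, Real.volume_Icc, sub_zero, ← ENNReal.ofReal_mul (by positivity)]
        ring_nf
    _ ≤ ∫⁻ y in Set.Icc (0 : ℝ) δ, gaussianPDF (-m) v y := by
        refine setLIntegral_mono' measurableSet_Icc fun y hy ↦ ENNReal.ofReal_le_ofReal ?_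
        have hy0 : 0 ≤ y := hy.1
        rw [gaussianPDFReal_neg_mean m v y, neg_div]
        refine mul_le_mul_of_nonneg_left (Real.exp_le_exp.2 (neg_le_neg ?_)) hp
        gcongr
        calc 2 * m * y + y ^ 2 = (2 * m + y) * y := by ring
          _ ≤ (2 * m + δ) * δ := by gcongr <;> exact hy.2
    _ ≤ _ := lintegral_mono_set fun y hy ↦ hy.1

end Terminal

/-! ### Paths reaching the level -/

section Path

variable {Ω : Type*} {W : ℝ≥0 → Ω → ℝ} {μ σ B : ℝ} {T : ℝ≥0} {ω : Ω}

/-- The excess `log X_T - log B` of the terminal logarithm of a geometric Brownian motion `X` over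
the logarithm of the level. -/
noncomputable def terminalExcess (μ σ B : ℝ) (W : ℝ≥0 → Ω → ℝ) (T : ℝ≥0) (ω : Ω) : ℝ :=
  σ * W T ω + ((μ - σ ^ 2 / 2) * T - Real.log B)

lemma gbm_eq_exp_bridge (μ σ B : ℝ) (W : ℝ≥0 → Ω → ℝ) (hT : 0 < T) (t : ℝ≥0) (ω : Ω) :
    gbm μ σ W t ω = Real.exp (σ * bridge W T t ω +
      t / T * (Real.log B + terminalExcess μ σ B W T ω)) := by
  have _ : (0 : ℝ) < T := hT
  rw [gbm, bridge, terminalExcess]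
  congr 1
  field_simp
  ring

lemma mem_reachSet_of_mem_hitEvent (hB : 0 < B) (hT : 0 < T) (hW : Continuous (W · ω))
    (h : ω ∈ hitEvent (gbm μ σ W) B T) :
    (fun n ↦ bridge W T (denseTime T n) ω) ∈
      reachSet σ (Real.log B) T (denseTime T) (terminalExcess μ σ B W T ω) := by
  intro j
  have hlt : Real.exp (Real.log B - 1 / (j + 1)) < ⨆ n, gbm μ σ W (denseTime T n) ω := by
    rw [← iSup_Icc_eq_iSup_denseTime (continuous_gbm hW μ σ) T]
    calc Real.exp (Real.log B - 1 / (j + 1)) < Real.exp (Real.log B) :=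
          Real.exp_lt_exp.2 (sub_lt_self _ (by positivity))
      _ = B := Real.exp_log hB
      _ ≤ _ := h
  obtain ⟨n, hn⟩ := exists_lt_of_lt_ciSup hlt
  rw [gbm_eq_exp_bridge μ σ B W hT, Real.exp_lt_exp] at hn
  exact ⟨n, hn.le⟩

lemma mem_hitEvent_of_terminalExcess_nonneg (hB : 0 < B) (hT : 0 < T) (hW : Continuous (W · ω))
    (h : 0 ≤ terminalExcess μ σ B W T ω) : ω ∈ hitEvent (gbm μ σ W) B T := by
  have hterminal : B ≤ gbm μ σ W T ω := by
    rw [gbm_eq_exp_bridge μ σ B W hT, bridge_self W hT, div_self (by positivity),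
      ← Real.log_le_iff_le_exp hB]
    linarith
  exact hterminal.trans (le_ciSup (bddAbove_range_Icc (continuous_gbm hW μ σ) T)
    (⟨T, zero_le, le_rfl⟩ : Set.Icc (0 : ℝ≥0) T))

lemma abs_exp_sub_exp_le (x y : ℝ) :
    |Real.exp x - Real.exp y| ≤ Real.exp y * (|x - y| * Real.exp |x - y|) := by
  have hfactor : Real.exp x - Real.exp y = Real.exp y * (Real.exp (x - y) - 1) := by
    rw [mul_sub, ← Real.exp_add, add_sub_cancel, mul_one]
  rw [hfactor, abs_mul, abs_of_pos (Real.exp_pos y)]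
  gcongr
  have hone := Complex.norm_exp_sub_sum_le_norm_mul_exp ((x - y : ℝ) : ℂ) 1
  rw [Finset.sum_range_one, pow_zero, Nat.factorial_zero, Nat.cast_one, div_one, pow_one,
    Complex.norm_real, Real.norm_eq_abs] at hone
  exact_mod_cast hone

lemma mul_exp_le_mul_exp_two_mul {s x y : ℝ} (hs0 : 0 ≤ s) (hs1 : s ≤ 1) (hx : 0 ≤ x)
    (hy : 0 ≤ y) :
    (s * x + y) * Real.exp (s * x + y) ≤ (s + y) * Real.exp y * Real.exp (2 * x) := by
  have hx_le : x ≤ Real.exp x := by linarith [Real.add_one_le_exp x]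
  calc (s * x + y) * Real.exp (s * x + y)
      ≤ (s * Real.exp x + y * Real.exp x) * Real.exp (x + y) := by
        gcongr
        · exact le_mul_of_one_le_right hy (Real.one_le_exp hx)
        · exact mul_le_of_le_one_left hx hs1
    _ = (s + y) * Real.exp y * Real.exp (2 * x) := by
        rw [two_mul, Real.exp_add, Real.exp_add]
        ring

lemma abs_gbm_sub_rpow_le (hσ : 0 < σ) (hB : 1 < B) (hT : 0 < T) (hT1 : T ≤ 1) {t : ℝ≥0}
    (ht : t ≤ T) :
    |gbm μ σ W t ω - B ^ ((t : ℝ) / T)| ≤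
      B * (√T + |terminalExcess μ σ B W T ω|) * Real.exp |terminalExcess μ σ B W T ω| *
        Real.exp (2 * σ * (|bridge W T t ω| / √T)) := by
  set Y := terminalExcess μ σ B W T ω
  set β := bridge W T t ω
  have hB0 : 0 < B := by linarith
  have hsqrt : 0 < √(T : ℝ) := Real.sqrt_pos.2 hT
  have hfrac : (t : ℝ) / T ≤ 1 := div_le_one_of_le₀ ht T.2
  have hdist : |σ * β + t / T * (Real.log B + Y) - Real.log B * (t / T)| ≤
      √T * (σ * (|β| / √T)) + |Y| := by
    calc |σ * β + t / T * (Real.log B + Y) - Real.log B * (t / T)|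
        = |σ * β + t / T * Y| := by ring_nf
      _ ≤ σ * |β| + t / T * |Y| := by
          refine (abs_add_le _ _).trans_eq ?_
          rw [abs_mul, abs_mul, abs_of_pos hσ, abs_of_nonneg (by positivity : (0 : ℝ) ≤ t / T)]
      _ ≤ σ * |β| + |Y| := by
          gcongr
          exact mul_le_of_le_one_left (abs_nonneg _) hfrac
      _ = √T * (σ * (|β| / √T)) + |Y| := by field_simp
  calc |gbm μ σ W t ω - B ^ ((t : ℝ) / T)|
      ≤ B ^ ((t : ℝ) / T) * ((√T * (σ * (|β| / √T)) + |Y|) *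
          Real.exp (√T * (σ * (|β| / √T)) + |Y|)) := by
        rw [gbm_eq_exp_bridge μ σ B W hT, Real.rpow_def_of_pos hB0]
        refine (abs_exp_sub_exp_le _ _).trans ?_
        gcongr
    _ ≤ B * ((√T + |Y|) * Real.exp |Y| * Real.exp (2 * (σ * (|β| / √T)))) :=
        mul_le_mul (Real.rpow_le_self_of_one_le hB.le hfrac)
          (mul_exp_le_mul_exp_two_mul hsqrt.le (Real.sqrt_le_one.2 (by exact_mod_cast hT1))
            (by positivity) (abs_nonneg _)) (by positivity) hB0.le
    _ = _ := by ring_nf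

lemma ofReal_exp_abs_bridge_le_expSup (hW : Continuous (W · ω)) (l : ℝ) {t : ℝ≥0} (ht : t ≤ T) :
    ENNReal.ofReal (Real.exp (l * (|bridge W T t ω| / √T))) ≤
      expSup l T (fun n ↦ bridge W T (denseTime T n) ω) := by
  refine le_of_forall_denseTime_le
    (f := fun t ↦ ENNReal.ofReal (Real.exp (l * (|bridge W T t ω| / √T)))) ?_ (fun n ↦ ?_) ht
  · refine ENNReal.continuous_ofReal.comp ?_
    unfold bridge
    fun_prop
  · exact le_iSup (fun n ↦ ENNReal.ofReal
      (Real.exp (l * (|bridge W T (denseTime T n) ω| / √T)))) n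

lemma ofReal_supDeviation_le (hσ : 0 < σ) (hB : 1 < B) (hT : 0 < T) (hT1 : T ≤ 1)
    (hW : Continuous (W · ω)) :
    ENNReal.ofReal (supDeviation (gbm μ σ W) B T ω) ≤
      ENNReal.ofReal (B * (√T + |terminalExcess μ σ B W T ω|) *
        Real.exp |terminalExcess μ σ B W T ω|) *
        expSup (2 * σ) T (fun n ↦ bridge W T (denseTime T n) ω) := by
  have _ : 0 < B := by linarith
  have _ : 0 < √(T : ℝ) := Real.sqrt_pos.2 hT
  have : Nonempty (Set.Icc (0 : ℝ≥0) T) := ⟨0, le_rfl, zero_le⟩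
  set A := B * (√T + |terminalExcess μ σ B W T ω|) * Real.exp |terminalExcess μ σ B W T ω|
  have hA : 0 < A := by positivity
  set Z := expSup (2 * σ) T (fun n ↦ bridge W T (denseTime T n) ω)
  rcases eq_or_ne Z ∞ with hZ | hZ
  · rw [hZ, ENNReal.mul_top (ENNReal.ofReal_pos.2 hA).ne']
    exact le_top
  · rw [ENNReal.ofReal_le_iff_le_toReal (ENNReal.mul_ne_top ENNReal.ofReal_ne_top hZ)]
    refine ciSup_le fun t ↦ (ENNReal.ofReal_le_iff_le_toReal
      (ENNReal.mul_ne_top ENNReal.ofReal_ne_top hZ)).1 ?_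
    calc _ ≤ ENNReal.ofReal (A * Real.exp (2 * σ * (|bridge W T t ω| / √T))) :=
          ENNReal.ofReal_le_ofReal (abs_gbm_sub_rpow_le hσ hB hT hT1 t.2.2)
      _ ≤ ENNReal.ofReal A * Z := by
          rw [ENNReal.ofReal_mul hA.le]
          gcongr
          exact ofReal_exp_abs_bridge_le_expSup hW _ t.2.2

end Path

/-! ### Small times -/

section SmallTime

variable {μ σ B : ℝ} {T : ℝ≥0}

/-- The variance of the terminal logarithm of a geometric Brownian motion. -/
noncomputable def terminalVar (σ : ℝ) (T : ℝ≥0) : ℝ≥0 := NNReal.mk (σ ^ 2) (sq_nonneg σ) * T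

lemma coe_terminalVar (σ : ℝ) (T : ℝ≥0) : (terminalVar σ T : ℝ) = σ ^ 2 * T := rfl

lemma terminalVar_pos (hσ : 0 < σ) (hT : 0 < T) : 0 < terminalVar σ T :=
  mul_pos (show (0 : ℝ) < σ ^ 2 by positivity) hT

/-- The amount by which the mean of the terminal logarithm of a geometric Brownian motion falls
short of the logarithm of the level. -/
noncomputable def meanShortfall (μ σ B : ℝ) (T : ℝ≥0) : ℝ := Real.log B - (μ - σ ^ 2 / 2) * T

/-- The times for which the estimates hold: variance and drift up to time `T` are small compared
with the logarithm of the level. -/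
structure IsSmallTime (μ σ B : ℝ) (T : ℝ≥0) : Prop where
  pos : 0 < T
  le_one : T ≤ 1
  terminalVar_le : 8 * (terminalVar σ T : ℝ) ≤ Real.log B
  drift_le : |μ - σ ^ 2 / 2| * T ≤ 1 / 8 * Real.log B

lemma exists_forall_lt_isSmallTime (μ σ : ℝ) (hB : 1 < B) :
    ∃ T₀ : ℝ≥0, 0 < T₀ ∧ ∀ T : ℝ≥0, 0 < T → T < T₀ → IsSmallTime μ σ B T := by
  have hb : 0 < Real.log B := Real.log_pos hB
  set d := 8 * (σ ^ 2 + |μ - σ ^ 2 / 2| + 1)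
  have hd : 0 < d := by positivity
  refine ⟨(min 1 (Real.log B / d)).toNNReal, Real.toNNReal_pos.2 (by positivity),
    fun T hT hTT₀ ↦ ?_⟩
  obtain ⟨hT1, hTd⟩ := lt_min_iff.1 (Real.lt_toNNReal_iff_coe_lt.1 hTT₀)
  rw [lt_div_iff₀ hd] at hTd
  have hvar : 0 ≤ σ ^ 2 * (T : ℝ) := by positivity
  have hdrift : 0 ≤ |μ - σ ^ 2 / 2| * (T : ℝ) := by positivity
  have hsplit : T * d = 8 * (σ ^ 2 * T) + 8 * (|μ - σ ^ 2 / 2| * T) + 8 * T := by ring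
  refine ⟨hT, by exact_mod_cast hT1.le, ?_, ?_⟩
  · rw [coe_terminalVar]
    linarith [hsplit, T.coe_nonneg]
  · linarith [hsplit, T.coe_nonneg]

lemma IsSmallTime.abs_meanShortfall_sub_le (h : IsSmallTime μ σ B T) :
    |meanShortfall μ σ B T - Real.log B| ≤ 1 / 8 * Real.log B := by
  rw [meanShortfall, sub_sub_cancel_left, abs_neg, abs_mul, abs_of_nonneg T.coe_nonneg]
  exact h.drift_le

lemma IsSmallTime.le_meanShortfall (h : IsSmallTime μ σ B T) :
    7 / 8 * Real.log B ≤ meanShortfall μ σ B T := by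
  linarith [(abs_le.1 h.abs_meanShortfall_sub_le).1]

lemma IsSmallTime.meanShortfall_le (h : IsSmallTime μ σ B T) :
    meanShortfall μ σ B T ≤ 9 / 8 * Real.log B := by
  linarith [(abs_le.1 h.abs_meanShortfall_sub_le).2]

/-- A lower bound for the probability of hitting the level `B` before time `T`. -/
noncomputable def hitLowerBound (μ σ B : ℝ) (T : ℝ≥0) : ℝ :=
  Real.exp (-((9 / 4 * Real.log B + 1) / (2 * σ ^ 2))) *
    (gaussianPDFReal (-meanShortfall μ σ B T) (terminalVar σ T) 0 * T)

lemma hitLowerBound_pos (μ B : ℝ) (hσ : 0 < σ) (hT : 0 < T) : 0 < hitLowerBound μ σ B T :=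
  mul_pos (Real.exp_pos _) (mul_pos (gaussianPDFReal_pos _ _ _ (terminalVar_pos hσ hT).ne') hT)

/-- The factor of `√T` in the bound for the conditional expectation of the deviation. -/
noncomputable def deviationConst (σ B : ℝ) : ℝ :=
  (expMomentConst (4 * (2 * σ)) ^ (1 / 4 : ℝ)).toReal *
    (B * ((1 + 8 * σ ^ 2 / Real.log B) * (16 * σ ^ 2 / Real.log B))) /
    Real.exp (-((9 / 4 * Real.log B + 1) / (2 * σ ^ 2)))

lemma expMomentConst_pos (l : ℝ) : 0 < expMomentConst l :=
  (ENNReal.mul_pos four_ne_zero (ENNReal.ofReal_pos.2 (Real.exp_pos _)).ne').trans_le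
    (ENNReal.le_tsum 0)

lemma deviationConst_pos (hσ : 0 < σ) (hB : 1 < B) : 0 < deviationConst σ B := by
  have hb : 0 < Real.log B := Real.log_pos hB
  have hK : 0 < (expMomentConst (4 * (2 * σ)) ^ (1 / 4 : ℝ)).toReal :=
    ENNReal.toReal_pos (ENNReal.rpow_pos (expMomentConst_pos _) (expMomentConst_ne_top _)).ne'
      (ENNReal.rpow_ne_top_of_nonneg (by norm_num) (expMomentConst_ne_top _))
  unfold deviationConst
  positivity

end SmallTime

/-! ### The conditional expectation of the deviation -/

section Expectation

variable {Ω : Type*} {mΩ : MeasurableSpace Ω} {P : Measure Ω} {W : ℝ≥0 → Ω → ℝ} {μ σ B : ℝ}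
  {T : ℝ≥0}

lemma hasLaw_terminalExcess (hW : IsPreBrownianReal W P) (μ σ B : ℝ) (T : ℝ≥0) :
    HasLaw (terminalExcess μ σ B W T)
      (gaussianReal (-meanShortfall μ σ B T) (terminalVar σ T)) P := by
  have hlaw := gaussianReal_add_const (gaussianReal_const_mul (hW.hasLaw_eval T) σ)
    ((μ - σ ^ 2 / 2) * T - Real.log B)
  have hmean : σ * 0 + ((μ - σ ^ 2 / 2) * T - Real.log B) = -meanShortfall μ σ B T := by
    rw [meanShortfall]
    ring
  rw [hmean] at hlaw
  exact hlaw

lemma indepFun_bridge_terminalExcess (hW : IsPreBrownianReal W P) (hT : 0 < T) (μ σ B : ℝ) :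
    IndepFun (fun ω n ↦ bridge W T (denseTime T n) ω) (terminalExcess μ σ B W T) P :=
  (indepFun_bridge hW hT (denseTime_le T)).comp (φ := id)
    (ψ := fun x ↦ σ * x + ((μ - σ ^ 2 / 2) * T - Real.log B)) measurable_id (by fun_prop)

lemma ofReal_hitLowerBound_le (hW : IsBrownianReal W P) (hσ : 0 < σ) (hB : 1 < B)
    (hT : IsSmallTime μ σ B T) :
    ENNReal.ofReal (hitLowerBound μ σ B T) ≤ P (hitEvent (gbm μ σ W) B T) := by
  have hb : 0 < Real.log B := Real.log_pos hB
  have hT0 : (0 : ℝ) < T := hT.pos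
  have hT1 : (T : ℝ) ≤ 1 := hT.le_one
  have hm0 : 0 ≤ meanShortfall μ σ B T := le_trans (by positivity) hT.le_meanShortfall
  have hlaw := hasLaw_terminalExcess hW.toIsPreBrownianReal μ σ B T
  have hexponent : (2 * meanShortfall μ σ B T + T) * T / (2 * terminalVar σ T) ≤
      (9 / 4 * Real.log B + 1) / (2 * σ ^ 2) := by
    rw [coe_terminalVar, ← mul_assoc, mul_div_mul_right _ _ hT0.ne']
    exact div_le_div_of_nonneg_right (by linarith [hT.meanShortfall_le]) (by positivity)
  calc ENNReal.ofReal (hitLowerBound μ σ B T)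
      ≤ gaussianReal (-meanShortfall μ σ B T) (terminalVar σ T) (Set.Ici 0) := by
        refine le_trans (ENNReal.ofReal_le_ofReal ?_) (ofReal_mul_le_gaussianReal_Ici hm0 hT0.le
          (terminalVar_pos hσ hT.pos).ne')
        exact mul_le_mul_of_nonneg_right (Real.exp_le_exp.2 (neg_le_neg hexponent))
          (mul_nonneg (gaussianPDFReal_nonneg _ _ _) hT0.le)
    _ = P (terminalExcess μ σ B W T ⁻¹' Set.Ici 0) := by
        rw [← hlaw.map_eq, Measure.map_apply_of_aemeasurable hlaw.aemeasurable measurableSet_Ici]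
    _ ≤ P (hitEvent (gbm μ σ W) B T) := by
        refine measure_mono_ae ?_
        filter_upwards [hW.cont] with ω hω h
        exact mem_hitEvent_of_terminalExcess_nonneg (by linarith) hT.pos hω h

/-- The bound for the deviation on the hitting event in terms of the sampled bridge and the terminal
excess; it vanishes where these two rule out hitting. -/
noncomputable def deviationBound (σ B : ℝ) (T : ℝ≥0) : (ℕ → ℝ) × ℝ → ℝ≥0∞ :=
  {p | p.1 ∈ reachSet σ (Real.log B) T (denseTime T) p.2}.indicator fun p ↦
    ENNReal.ofReal (B * (√T + |p.2|) * Real.exp |p.2|) * expSup (2 * σ) T p.1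

lemma measurable_deviationBound (σ B : ℝ) (T : ℝ≥0) : Measurable (deviationBound σ B T) := by
  refine Measurable.indicator (Measurable.mul (by fun_prop) ?_) (measurableSet_reachSet _ _ _ _)
  exact (measurable_expSup _ _).comp measurable_fst

lemma indicator_supDeviation_le_deviationBound (hσ : 0 < σ) (hB : 1 < B) (hT : 0 < T)
    (hT1 : T ≤ 1) {ω : Ω} (hW : Continuous (W · ω)) :
    (hitEvent (gbm μ σ W) B T).indicator
        (fun ω ↦ ENNReal.ofReal (supDeviation (gbm μ σ W) B T ω)) ω ≤
      deviationBound σ B T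
        (fun n ↦ bridge W T (denseTime T n) ω, terminalExcess μ σ B W T ω) := by
  by_cases hω : ω ∈ hitEvent (gbm μ σ W) B T
  swap
  · exact (Set.indicator_of_notMem hω _).trans_le zero_le
  have hreach := mem_reachSet_of_mem_hitEvent (by linarith) hT hW hω
  rw [Set.indicator_of_mem hω, deviationBound, Set.indicator_of_mem (by exact hreach)]
  exact ofReal_supDeviation_le hσ hB hT hT1 hW

lemma lintegral_deviationBound_bridge_le [IsProbabilityMeasure P] (hW : IsPreBrownianReal W P)
    (hWm : ∀ t, Measurable (W t)) (hσ : 0 < σ) (hB : 0 ≤ B) (hT : 0 < T) (y : ℝ) :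
    ∫⁻ ω, deviationBound σ B T (fun n ↦ bridge W T (denseTime T n) ω, y) ∂P ≤
      expMomentConst (4 * (2 * σ)) ^ (1 / 4 : ℝ) * ENNReal.ofReal B *
        ENNReal.ofReal ((√T + |y|) * Real.exp |y| *
          Real.exp (3 / 2 * Real.log B * min y 0 / terminalVar σ T)) := by
  have hβ : Measurable fun ω n ↦ bridge W T (denseTime T n) ω :=
    measurable_pi_lambda _ fun n ↦ measurable_bridge hWm T (denseTime T n)
  have hS : MeasurableSet
      {ω | (fun n ↦ bridge W T (denseTime T n) ω) ∈ reachSet σ (Real.log B) T (denseTime T) y} :=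
    (hβ.prodMk measurable_const) (measurableSet_reachSet _ _ _ _)
  calc ∫⁻ ω, deviationBound σ B T (fun n ↦ bridge W T (denseTime T n) ω, y) ∂P
      = ENNReal.ofReal (B * (√T + |y|) * Real.exp |y|) *
        ∫⁻ ω in {ω | (fun n ↦ bridge W T (denseTime T n) ω) ∈
            reachSet σ (Real.log B) T (denseTime T) y},
          expSup (2 * σ) T (fun n ↦ bridge W T (denseTime T n) ω) ∂P := by
        rw [← lintegral_const_mul' _ _ ENNReal.ofReal_ne_top, ← lintegral_indicator hS]
        rfl
    _ ≤ ENNReal.ofReal (B * (√T + |y|) * Real.exp |y|) *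
        (expMomentConst (4 * (2 * σ)) ^ (1 / 4 : ℝ) * ENNReal.ofReal
          (Real.exp (3 / 2 * Real.log B * min y 0 / (σ ^ 2 * T)))) := by
        gcongr
        exact setLIntegral_expSup_reachSet_le hW hWm hT (denseTime_le T) hσ _ y (by positivity)
    _ = _ := by
        rw [coe_terminalVar, mul_left_comm, mul_assoc (_ ^ _), ← ENNReal.ofReal_mul (by positivity),
          ← ENNReal.ofReal_mul hB]
        ring_nf

lemma setLIntegral_supDeviation_le [IsProbabilityMeasure P] (hW : IsBrownianReal W P)
    (hWm : ∀ t, Measurable (W t)) (hσ : 0 < σ) (hB : 1 < B) (hT : IsSmallTime μ σ B T)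
    (hhit : NullMeasurableSet (hitEvent (gbm μ σ W) B T) P) :
    ∫⁻ ω in hitEvent (gbm μ σ W) B T, ENNReal.ofReal (supDeviation (gbm μ σ W) B T ω) ∂P ≤
      expMomentConst (4 * (2 * σ)) ^ (1 / 4 : ℝ) * ENNReal.ofReal B *
        ENNReal.ofReal (gaussianPDFReal (-meanShortfall μ σ B T) (terminalVar σ T) 0 * √T *
          (1 + 8 * terminalVar σ T / (Real.log B * T)) *
          (16 * terminalVar σ T / Real.log B)) := by
  have hβ : Measurable fun ω n ↦ bridge W T (denseTime T n) ω :=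
    measurable_pi_lambda _ fun n ↦ measurable_bridge hWm T (denseTime T n)
  have hlaw := hasLaw_terminalExcess hW.toIsPreBrownianReal μ σ B T
  calc _ ≤ ∫⁻ ω, deviationBound σ B T
        (fun n ↦ bridge W T (denseTime T n) ω, terminalExcess μ σ B W T ω) ∂P := by
        rw [← lintegral_indicator₀ hhit]
        refine lintegral_mono_ae ?_
        filter_upwards [hW.cont] with ω hω
        exact indicator_supDeviation_le_deviationBound hσ hB hT.pos hT.le_one hω
    _ = ∫⁻ y, ∫⁻ ω, deviationBound σ B T (fun n ↦ bridge W T (denseTime T n) ω, y) ∂P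
          ∂(gaussianReal (-meanShortfall μ σ B T) (terminalVar σ T)) := by
        rw [← hlaw.map_eq]
        exact lintegral_comp_prodMk_of_indepFun hβ hlaw.aemeasurable
          (indepFun_bridge_terminalExcess hW.toIsPreBrownianReal hT.pos μ σ B)
          (measurable_deviationBound σ B T)
    _ ≤ _ := by
        refine (lintegral_mono fun y ↦ lintegral_deviationBound_bridge_le hW.toIsPreBrownianReal
          hWm hσ (by linarith) hT.pos y).trans ?_
        rw [lintegral_const_mul _ (by fun_prop)]
        gcongr
        exact lintegral_gaussianReal_tilt_le hT.pos hT.le_one (terminalVar_pos hσ hT.pos)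
          hT.terminalVar_le hT.le_meanShortfall hT.meanShortfall_le

lemma deviationConst_mul_hitLowerBound (hσ : 0 < σ) (hB : 0 ≤ B) (hT : 0 < T) :
    expMomentConst (4 * (2 * σ)) ^ (1 / 4 : ℝ) * ENNReal.ofReal B *
        ENNReal.ofReal (gaussianPDFReal (-meanShortfall μ σ B T) (terminalVar σ T) 0 * √T *
          (1 + 8 * terminalVar σ T / (Real.log B * T)) * (16 * terminalVar σ T / Real.log B)) =
      ENNReal.ofReal (deviationConst σ B * √T) * ENNReal.ofReal (hitLowerBound μ σ B T) := by
  have hK : expMomentConst (4 * (2 * σ)) ^ (1 / 4 : ℝ) ≠ ∞ :=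
    ENNReal.rpow_ne_top_of_nonneg (by norm_num) (expMomentConst_ne_top _)
  rw [← ENNReal.ofReal_mul' (hitLowerBound_pos μ B hσ hT).le, ← ENNReal.ofReal_toReal hK,
    ← ENNReal.ofReal_mul ENNReal.toReal_nonneg, ← ENNReal.ofReal_mul (by positivity),
    deviationConst, hitLowerBound, coe_terminalVar]
  congr 1
  field_simp

lemma lintegral_cond_le {f : Ω → ℝ≥0∞} {A : Set Ω} {K d : ℝ≥0∞}
    (hnum : ∫⁻ ω in A, f ω ∂P ≤ K * d) (hden : d ≤ P A) : ∫⁻ ω, f ω ∂(cond P A) ≤ K := by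
  rw [ProbabilityTheory.cond, lintegral_smul_measure, smul_eq_mul]
  calc (P A)⁻¹ * ∫⁻ ω in A, f ω ∂P ≤ (P A)⁻¹ * (K * P A) := by
        gcongr
        exact hnum.trans (by gcongr)
    _ = K * (P A * (P A)⁻¹) := by ring
    _ ≤ K := mul_le_of_le_one_right' (ENNReal.mul_inv_le_one _)

lemma integrable_and_integral_le_of_lintegral_ofReal_le {f : Ω → ℝ} {c : ℝ}
    (hf : AEStronglyMeasurable f P) (hf0 : 0 ≤ f) (hc : 0 ≤ c)
    (h : ∫⁻ ω, ENNReal.ofReal (f ω) ∂P ≤ ENNReal.ofReal c) :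
    Integrable f P ∧ ∫ ω, f ω ∂P ≤ c := by
  have hf0' : 0 ≤ᵐ[P] f := Eventually.of_forall hf0
  refine ⟨(lintegral_ofReal_ne_top_iff_integrable hf hf0').1
    (ne_top_of_le_ne_top ENNReal.ofReal_ne_top h), ?_⟩
  rw [integral_eq_lintegral_of_nonneg_ae hf0' hf]
  exact ENNReal.toReal_le_of_le_ofReal hc h

lemma nullMeasurableSet_hitEvent {X : ℝ≥0 → Ω → ℝ} (hX : ∀ t, Measurable (X t))
    (hc : ∀ᵐ ω ∂P, Continuous (X · ω)) (B : ℝ) (T : ℝ≥0) :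
    NullMeasurableSet (hitEvent X B T) P :=
  nullMeasurableSet_le aemeasurable_const (aemeasurable_iSup_Icc hX hc T)

lemma aemeasurable_supDeviation {X : ℝ≥0 → Ω → ℝ} (hX : ∀ t, Measurable (X t))
    (hc : ∀ᵐ ω ∂P, Continuous (X · ω)) (hB : 0 < B) (T : ℝ≥0) :
    AEMeasurable (supDeviation X B T) P := by
  refine aemeasurable_iSup_Icc (Z := fun t ω ↦ |X t ω - B ^ ((t : ℝ) / (T : ℝ))|)
    (fun t ↦ ((hX t).sub_const _).abs) ?_ T
  filter_upwards [hc] with ω hω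
  exact (hω.sub (continuous_const.rpow (by fun_prop) fun _ ↦ Or.inl hB.ne')).abs

lemma measurable_gbm (hWm : ∀ t, Measurable (W t)) (μ σ : ℝ) (t : ℝ≥0) :
    Measurable (gbm μ σ W t) :=
  (((hWm t).const_mul σ).add_const _).exp

theorem integral_supDeviation_gbm_le [IsProbabilityMeasure P] (hW : IsBrownianReal W P)
    (hWm : ∀ t, Measurable (W t)) (hσ : 0 < σ) (hB : 1 < B) (hT : IsSmallTime μ σ B T) :
    Integrable (supDeviation (gbm μ σ W) B T) (cond P (hitEvent (gbm μ σ W) B T)) ∧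
      ∫ ω, supDeviation (gbm μ σ W) B T ω ∂(cond P (hitEvent (gbm μ σ W) B T)) ≤
        deviationConst σ B * √T := by
  have hX := measurable_gbm hWm μ σ
  have hc : ∀ᵐ ω ∂P, Continuous (gbm μ σ W · ω) := by
    filter_upwards [hW.cont] with ω hω using continuous_gbm hω μ σ
  have hB0 : 0 < B := by linarith
  have hdev := (aemeasurable_supDeviation hX hc hB0 T).mono_ac
    (cond_absolutelyContinuous (s := hitEvent (gbm μ σ W) B T))
  have hnum := (setLIntegral_supDeviation_le hW hWm hσ hB hT
    (nullMeasurableSet_hitEvent hX hc B T)).trans_eq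
    (deviationConst_mul_hitLowerBound hσ hB0.le hT.pos)
  exact integrable_and_integral_le_of_lintegral_ofReal_le hdev.aestronglyMeasurable
    (fun ω ↦ Real.iSup_nonneg fun _ ↦ abs_nonneg _)
    (mul_nonneg (deviationConst_pos hσ hB).le (Real.sqrt_nonneg _))
    (lintegral_cond_le hnum (ofReal_hitLowerBound_le hW hσ hB hT))

end Expectation

/-! ### Solutions of the stochastic differential equation -/

section Solutions

variable {Ω : Type*} {mΩ : MeasurableSpace Ω} {𝓕 : Filtration ℝ≥0 mΩ} {P : Measure Ω}
  {W X Y : ℝ≥0 → Ω → ℝ} {μ σ : ℝ}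

lemma gbm_neg_neg (μ σ : ℝ) (W : ℝ≥0 → Ω → ℝ) : gbm μ (-σ) (-W) = gbm μ σ W := by
  ext t ω
  simp [gbm]

lemma IsGeometricBrownianMotion.exists_ae_eq_gbm_abs [IsProbabilityMeasure P]
    (hX : IsGeometricBrownianMotion 𝓕 W P μ σ X) (hW : IsBrownianWrt 𝓕 W P) :
    ∃ V : ℝ≥0 → Ω → ℝ, IsBrownianReal V P ∧ (∀ t, Measurable (V t)) ∧
      ∀ᵐ ω ∂P, ∀ t, X t ω = gbm μ |σ| V t ω := by
  have hWm t : Measurable (W t) := (hW.adapted t).mono (𝓕.le t) le_rfl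
  rcases abs_choice σ with hσ | hσ
  · exact ⟨W, hW.isBrownian, hWm, hσ.symm ▸ hX.ae_eq_gbm hW⟩
  · refine ⟨-W, hW.isBrownian.neg, fun t ↦ (hWm t).neg, ?_⟩
    rw [hσ, gbm_neg_neg]
    exact hX.ae_eq_gbm hW

lemma hitEvent_congr_ae (h : ∀ᵐ ω ∂P, ∀ t, X t ω = Y t ω) (B : ℝ) (T : ℝ≥0) :
    hitEvent X B T =ᵐ[P] hitEvent Y B T := by
  filter_upwards [h] with ω hω
  exact congrArg (B ≤ ·) (iSup_congr fun t ↦ hω t)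

lemma supDeviation_congr_ae (h : ∀ᵐ ω ∂P, ∀ t, X t ω = Y t ω) (B : ℝ) (T : ℝ≥0) :
    supDeviation X B T =ᵐ[P] supDeviation Y B T := by
  filter_upwards [h] with ω hω
  simp only [supDeviation, hω]

lemma cond_congr_ae {A A' : Set Ω} (h : A =ᵐ[P] A') : cond P A = cond P A' := by
  rw [ProbabilityTheory.cond, ProbabilityTheory.cond, measure_congr h, Measure.restrict_congr_set h]

end Solutions

theorem theorem1_general (μ σ B : ℝ) (hσ : σ ≠ 0) (hB : 1 < B) :
    ∃ C : ℝ, 0 < C ∧ ∃ T₀ : ℝ≥0, 0 < T₀ ∧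
      ∀ (Ω : Type*) (mΩ : MeasurableSpace Ω) (P : Measure Ω) (_ : IsProbabilityMeasure P)
        (𝓕 : Filtration ℝ≥0 mΩ) (W X : ℝ≥0 → Ω → ℝ),
        IsBrownianWrt 𝓕 W P → IsGeometricBrownianMotion 𝓕 W P μ σ X →
        ∀ T : ℝ≥0, 0 < T → T < T₀ →
          0 < P (hitEvent X B T) ∧
          Integrable (supDeviation X B T) (ProbabilityTheory.cond P (hitEvent X B T)) ∧
          ∫ ω, supDeviation X B T ω ∂(ProbabilityTheory.cond P (hitEvent X B T))
            ≤ C * Real.sqrt T := by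
  have hσ' : 0 < |σ| := abs_pos.2 hσ
  obtain ⟨T₀, hT₀, hsmall⟩ := exists_forall_lt_isSmallTime μ |σ| hB
  refine ⟨deviationConst |σ| B, deviationConst_pos hσ' hB, T₀, hT₀,
    fun Ω mΩ P _ 𝓕 W X hW hX T hT hTT₀ ↦ ?_⟩
  obtain ⟨V, hV, hVm, hXV⟩ := hX.exists_ae_eq_gbm_abs hW
  have hhit := hitEvent_congr_ae hXV B T
  have hdev := (cond_absolutelyContinuous (μ := P) (s := hitEvent (gbm μ |σ| V) B T)).ae_eq
    (supDeviation_congr_ae hXV B T)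
  rw [measure_congr hhit, cond_congr_ae hhit, integrable_congr hdev, integral_congr_ae hdev]
  exact ⟨(ENNReal.ofReal_pos.2 (hitLowerBound_pos μ B hσ' hT)).trans_le
      (ofReal_hitLowerBound_le hV hσ' hB (hsmall T hT hTT₀)),
    integral_supDeviation_gbm_le hV hVm hσ' hB (hsmall T hT hTT₀)⟩

theorem theorem1 (μ σ B : ℝ) (hμ : 0 < μ) (hσ : 0 < σ) (hB : 1 < B) :
    ∃ C : ℝ, 0 < C ∧ ∃ T₀ : ℝ≥0, 0 < T₀ ∧
      ∀ (Ω : Type*) (mΩ : MeasurableSpace Ω) (P : Measure Ω) (_ : IsProbabilityMeasure P)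
        (𝓕 : Filtration ℝ≥0 mΩ) (W X : ℝ≥0 → Ω → ℝ),
        IsBrownianWrt 𝓕 W P → IsGeometricBrownianMotion 𝓕 W P μ σ X →
        ∀ T : ℝ≥0, 0 < T → T < T₀ →
          0 < P (hitEvent X B T) ∧
          Integrable (supDeviation X B T) (ProbabilityTheory.cond P (hitEvent X B T)) ∧
          ∫ ω, supDeviation X B T ω ∂(ProbabilityTheory.cond P (hitEvent X B T))
            ≤ C * Real.sqrt T :=
  theorem1_general μ σ B hσ.ne' hB
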